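/- Let $A$ be a left noetherian ring and let $\omega\in A$ be regular ($a\omega=0$ or $\omega a=0$ implies $a=0$) and normal ($A\omega=\omega A$). Let $\sigma$ be the unique ring automorphism of $A$ with $\omega a=\sigma(a)\omega$ for all $a\in A$; for a left $A$-module $X$ let ${}^{\sigma}X$ be the same abelian group with action $a\cdot x=\sigma(a)x$, and let $\omega_X\colon X\to{}^{\sigma}X$, $x\mapsto\omega x$. Let $n\ge 1$. An $n$-fold module factorization of $\omega$ is a sequence of $A$-linear maps $$X^0\xrightarrow{d^0}X^1\xrightarrow{d^1}\cdots\xrightarrow{d^{n-2}}X^{n-1}\xrightarrow{d^{n-1}}{}^{\sigma}X^0$$ such that, for each $0\le i\le n-1$, the $n$-fold composition $X^i\to\cdots\to X^{n-1}\to{}^{\sigma}X^0\to\cdots\to{}^{\sigma}X^i$ equals $\omega_{X^i}$. A morphism is a family of $A$-linear maps $f^i\colon X^i\to Y^i$ $(0\le i\le n-1)$ commuting with all the structure maps (with ${}^{\sigma}f^0$ at the right-hand end). Let $\mathsf F_n(A;\omega)$ be the resulting category. For an $A$-module $M$ and $0\le i\le n-1$ let $\theta^i(M)$ be the module factorization with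 components ${}^{\sigma^{-1}}M$ in positions $j<i$ and $M$ in positions $j\ge i$, whose structure maps are identities, except that the map from position $i-1$ to position $i$ is $\omega$ if $i>0$, and that the last map $M\to{}^{\sigma}M$ is $\omega$ if $i=0$. An object $G$ of an abelian category is Gorenstein projective if $G\cong\operatorname{Ker}(d^0)$ for some exact complex $P^\bullet$ of projective objects such that $\operatorname{Hom}(P^\bullet,Q)$ is acyclic for every projective object $Q$. Write $\mathcal{GP}(\mathsf F_n(A;\omega))$ for the full subcategory of Gorenstein projective objects of $\mathsf F_n(A;\omega)$, and $\mathsf{GF}_n(A;\omega)$ for the full subcategory of those $X\in\mathsf F_n(A;\omega)$ all of whose components $X^0,\dots,X^{n-1}$ are Gorenstein projective $A$-modules. Let $\Gamma_n\subseteq M_n(A)$ be the subring of matrices whose entries below the diagonal lie in $A\omega$, and let $\Gamma_n\text{-GProj}$ be the full subcategory of Gorenstein projective left $\Gamma_n$-modules. Each of these full subcategories is equipped with the class of short exact sequences of the ambient abelian category all of whose terms lie in the subcategory. Then: 1. $\mathsf{GF}_n(A;\omega)=\mathcal{GP}(\mathsf F_n(A;\omega))$. 2. $\mathsf{GF}_n(A;\omega)$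 and $\Gamma_n\text{-GProj}$ are equivalent as exact categories, i.e. there is an additive equivalence between them which preserves and reflects the chosen short exact sequences. 3. $\mathsf{GF}_n(A;\omega)$ is a Frobenius exact category: it is an exact category in the sense of Quillen with enough projective and enough injective objects, and its projective objects coincide with its injective objects. 4. An object $X$ of $\mathsf F_n(A;\omega)$ lies in $\mathsf{GF}_n(A;\omega)$ and is projective-injective there if and only if $X$ is a direct summand of $\theta^0(P^0)\oplus\theta^1(P^1)\oplus\cdots\oplus\theta^{n-1}(P^{n-1})$ for some projective $A$-modules $P^0,\dots,P^{n-1}$. -/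

import Mathlib

open CategoryTheory CategoryTheory.Limits

universe u v w

namespace NFold

/-! ## Regular normal elements and the induced automorphism -/

/-- `ω` is regular (`a ω = 0` or `ω a = 0` implies `a = 0`) and normal (`A ω = ω A`). -/
structure IsRegularNormal {A : Type u} [Ring A] (ω : A) : Prop where
  eq_zero_of_mul_right : ∀ a : A, a * ω = 0 → a = 0
  eq_zero_of_mul_left : ∀ a : A, ω * a = 0 → a = 0
  normal : Set.range (fun a : A => a * ω) = Set.range (fun a : A => ω * a)

namespace IsRegularNormal

variable {A : Type u} [Ring A] {ω : A}

theorem right_cancel (h : IsRegularNormal ω) {a b : A} (e : a * ω = b * ω) : a = b :=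
  sub_eq_zero.mp (h.eq_zero_of_mul_right _ (by rw [sub_mul, e, sub_self]))

theorem left_cancel (h : IsRegularNormal ω) {a b : A} (e : ω * a = ω * b) : a = b :=
  sub_eq_zero.mp (h.eq_zero_of_mul_left _ (by rw [mul_sub, e, sub_self]))

theorem exists_left (h : IsRegularNormal ω) (a : A) : ∃ b : A, b * ω = ω * a := by
  have : ω * a ∈ Set.range (fun a : A => a * ω) := by
    rw [h.normal]; exact ⟨a, rfl⟩
  exact this

theorem exists_right (h : IsRegularNormal ω) (a : A) : ∃ b : A, ω * b = a * ω := by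
  have : a * ω ∈ Set.range (fun a : A => ω * a) := by
    rw [← h.normal]; exact ⟨a, rfl⟩
  exact this

/-- The unique ring automorphism `σ` of `A` with `ω a = σ(a) ω`. -/
noncomputable def sigma (h : IsRegularNormal ω) : A ≃+* A where
  toFun a := (h.exists_left a).choose
  invFun a := (h.exists_right a).choose
  left_inv a := h.left_cancel
    ((h.exists_right _).choose_spec.trans (h.exists_left a).choose_spec)
  right_inv a := h.right_cancel
    ((h.exists_left _).choose_spec.trans (h.exists_right a).choose_spec)
  map_mul' a b := h.right_cancel (by
    rw [(h.exists_left (a * b)).choose_spec, mul_assoc, (h.exists_left b).choose_spec,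
      ← mul_assoc, ← mul_assoc, (h.exists_left a).choose_spec])
  map_add' a b := h.right_cancel (by
    rw [(h.exists_left (a + b)).choose_spec, add_mul, (h.exists_left b).choose_spec,
      (h.exists_left a).choose_spec, mul_add])

theorem sigma_mul (h : IsRegularNormal ω) (a : A) : h.sigma a * ω = ω * a :=
  (h.exists_left a).choose_spec

theorem mul_sigma_symm (h : IsRegularNormal ω) (a : A) : ω * h.sigma.symm a = a * ω := by
  rw [← h.sigma_mul, RingEquiv.apply_symm_apply]

/-- The twist functor `X ↦ ^σ X`: same abelian group, with `a · x = σ(a) x`. -/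
noncomputable abbrev twist (h : IsRegularNormal ω) : ModuleCat.{u} A ⥤ ModuleCat.{u} A :=
  ModuleCat.restrictScalars (h.sigma : A →+* A)

/-- The canonical morphism `ω_X : X ⟶ ^σ X`, `x ↦ ω x`. -/
noncomputable def omegaHom (h : IsRegularNormal ω) (X : ModuleCat.{u} A) :
    X ⟶ h.twist.obj X :=
  ModuleCat.ofHom (Y := h.twist.obj X)
    { toFun := fun x => (ω • x : X)
      map_add' := fun x y => smul_add ω x y
      map_smul' := fun a x => by
        change (ω • (a • x) : X) = h.sigma a • (ω • x : X)
        rw [← mul_smul, ← mul_smul, h.sigma_mul] }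

end IsRegularNormal

/-! ## The category of `n`-fold module factorizations -/

/-- The last index `n - 1`. -/
def lastIdx (n : ℕ) [NeZero n] : Fin n := ⟨n - 1, Nat.sub_lt (NeZero.pos n) one_pos⟩

theorem le_lastIdx {n : ℕ} [NeZero n] (i : Fin n) : i ≤ lastIdx n :=
  Fin.le_def.mpr (Nat.le_sub_one_of_lt i.isLt)

theorem zero_le_idx {n : ℕ} [NeZero n] (i : Fin n) : 0 ≤ i :=
  Fin.le_def.mpr (by simp)

theorem idx_pos {n : ℕ} [NeZero n] {i : Fin n} (hi : i ≠ 0) : 0 < i :=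
  lt_of_le_of_ne (zero_le_idx i) (Ne.symm hi)

/-- An `n`-fold module factorization of `ω`: a sequence
`X⁰ ⟶ X¹ ⟶ ⋯ ⟶ Xⁿ⁻¹ ⟶ ^σ(X⁰)` of `n` morphisms of `A`-modules all of whose `n`-fold compositions
`Xⁱ ⟶ ⋯ ⟶ Xⁿ⁻¹ ⟶ ^σ(X⁰) ⟶ ⋯ ⟶ ^σ(Xⁱ)` equal `ω`. The first `n - 1` morphisms are encoded as a
functor from the linearly ordered set `Fin n`. -/
structure ModFact {A : Type u} [Ring A] {ω : A} (h : IsRegularNormal ω) (n : ℕ) [NeZero n] where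
  seq : Fin n ⥤ ModuleCat.{u} A
  last : seq.obj (lastIdx n) ⟶ h.twist.obj (seq.obj 0)
  comp_eq : ∀ i : Fin n,
    seq.map (homOfLE (le_lastIdx i)) ≫ last ≫ h.twist.map (seq.map (homOfLE (zero_le_idx i))) =
      h.omegaHom (seq.obj i)

namespace ModFact

variable {A : Type u} [Ring A] {ω : A} {h : IsRegularNormal ω} {n : ℕ} [NeZero n]

/-- Morphisms of module factorizations: families of morphisms commuting with all structure
maps. -/
@[ext]
structure Hom (X Y : ModFact h n) where
  app : X.seq ⟶ Y.seq
  comm : X.last ≫ h.twist.map (app.app 0) = app.app (lastIdx n) ≫ Y.last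

noncomputable instance category : Category.{u} (ModFact h n) where
  Hom X Y := Hom X Y
  id X := ⟨𝟙 _, by simp⟩
  comp f g := ⟨f.app ≫ g.app, by
    simp only [NatTrans.comp_app, Functor.map_comp, Category.assoc, ← g.comm]
    rw [← Category.assoc, f.comm, Category.assoc]⟩
  id_comp f := Hom.ext (Category.id_comp _)
  comp_id f := Hom.ext (Category.comp_id _)
  assoc f g k := Hom.ext (Category.assoc _ _ _)

@[ext]
theorem hom_ext {X Y : ModFact h n} {f g : X ⟶ Y} (e : Hom.app f = Hom.app g) : f = g :=
  Hom.ext e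

theorem twist_map_add {M N : ModuleCat.{u} A} (f g : M ⟶ N) :
    h.twist.map (f + g) = h.twist.map f + h.twist.map g := rfl

theorem twist_map_zero {M N : ModuleCat.{u} A} :
    h.twist.map (0 : M ⟶ N) = 0 := rfl

theorem twist_map_neg {M N : ModuleCat.{u} A} (f : M ⟶ N) :
    h.twist.map (-f) = -h.twist.map f := rfl

noncomputable instance homAdd (X Y : ModFact h n) : Add (X ⟶ Y) where
  add f g := ⟨Hom.app f + Hom.app g, by
    rw [NatTrans.app_add, NatTrans.app_add, twist_map_add, Preadditive.comp_add,
      Preadditive.add_comp, Hom.comm f, Hom.comm g]⟩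

noncomputable instance homZero (X Y : ModFact h n) : Zero (X ⟶ Y) where
  zero := ⟨0, by
    rw [NatTrans.app_zero, NatTrans.app_zero, twist_map_zero, comp_zero, zero_comp]⟩

noncomputable instance homNeg (X Y : ModFact h n) : Neg (X ⟶ Y) where
  neg f := ⟨-Hom.app f, by
    rw [NatTrans.app_neg, NatTrans.app_neg, twist_map_neg, Preadditive.comp_neg,
      Preadditive.neg_comp, Hom.comm f]⟩

/-- Componentwise addition of morphisms. -/
noncomputable instance homAddCommGroup (X Y : ModFact h n) : AddCommGroup (X ⟶ Y) where
  add_assoc f g k := hom_ext (add_assoc (Hom.app f) (Hom.app g) (Hom.app k))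
  zero_add f := hom_ext (zero_add (Hom.app f))
  add_zero f := hom_ext (add_zero (Hom.app f))
  neg_add_cancel f := hom_ext (neg_add_cancel (Hom.app f))
  add_comm f g := hom_ext (add_comm (Hom.app f) (Hom.app g))
  nsmul := nsmulRec
  zsmul := zsmulRec

noncomputable instance preadditive : Preadditive (ModFact h n) where
  add_comp X Y Z f g k := hom_ext (Preadditive.add_comp _ _ _ (Hom.app f) (Hom.app g) (Hom.app k))
  comp_add X Y Z f g k := hom_ext (Preadditive.comp_add _ _ _ (Hom.app f) (Hom.app g) (Hom.app k))

/-- The `i`-th component `Xⁱ`. -/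
abbrev component (X : ModFact h n) (i : Fin n) : ModuleCat.{u} A := X.seq.obj i

end ModFact

/-! ## The trivial module factorizations -/

section Theta

set_option linter.unusedSectionVars false

variable {A : Type u} [Ring A] {ω : A} (h : IsRegularNormal ω) {n : ℕ} [NeZero n]

/-- The twist occurring in the `j`-th component of `θⁱ(M)`: `σ⁻¹` for `j < i`, else trivial. -/
noncomputable def thetaTwist (i j : Fin n) : A →+* A :=
  if j < i then (h.sigma.symm : A →+* A) else RingHom.id A

/-- The `j`-th component of `θⁱ(M)`: `^{σ⁻¹}M` for `j < i`, and `M` for `i ≤ j`. -/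
noncomputable abbrev thetaObj (M : ModuleCat.{u} A) (i j : Fin n) : ModuleCat.{u} A :=
  (ModuleCat.restrictScalars (thetaTwist h i j)).obj M

/-- The scalar by which the structure map `(θⁱ(M))ʲ ⟶ (θⁱ(M))ᵏ`, `j ≤ k`, acts on the common
underlying group: `ω` if `j < i ≤ k`, and `1` otherwise. -/
def thetaScalar (ω : A) (i j k : Fin n) : A := if j < i ∧ i ≤ k then ω else 1

theorem thetaScalar_mul {i j k : Fin n} (hjk : j ≤ k) (a : A) :
    thetaScalar ω i j k * thetaTwist h i j a = thetaTwist h i k a * thetaScalar ω i j k := by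
  unfold thetaScalar thetaTwist
  by_cases hj : j < i
  · by_cases hk : i ≤ k
    · rw [if_pos (And.intro hj hk), if_pos hj, if_neg (not_lt.mpr hk)]
      exact h.mul_sigma_symm a
    · rw [if_neg (fun c : j < i ∧ i ≤ k => hk c.2), if_pos hj, if_pos (not_le.mp hk), one_mul,
        mul_one]
  · rw [if_neg (fun c : j < i ∧ i ≤ k => hj c.1), if_neg hj,
      if_neg (fun c : k < i => hj (lt_of_le_of_lt hjk c)), one_mul, mul_one]

theorem thetaScalar_self (i j : Fin n) : thetaScalar ω i j j = 1 :=
  if_neg (fun c => absurd c.1 (not_lt.mpr c.2))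

theorem thetaScalar_comp {i j k l : Fin n} (hjk : j ≤ k) (hkl : k ≤ l) :
    thetaScalar ω i j l = thetaScalar ω i k l * thetaScalar ω i j k := by
  unfold thetaScalar
  by_cases h1 : k < i
  · simp [h1, not_le.mpr h1, lt_of_le_of_lt hjk h1]
  · have h2 : i ≤ k := not_lt.mp h1
    simp [h1, h2, h2.trans hkl]

/-- The structure map from the `j`-th to the `k`-th component of `θⁱ(M)` for `j ≤ k`: on the
common underlying group it is `x ↦ ω x` if `j < i ≤ k`, and the identity otherwise. -/
noncomputable def thetaMap (M : ModuleCat.{u} A) (i : Fin n) {j k : Fin n} (hjk : j ≤ k) :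
    thetaObj h M i j ⟶ thetaObj h M i k :=
  ModuleCat.ofHom (X := thetaObj h M i j) (Y := thetaObj h M i k)
    { toFun := fun (x : M) => (thetaScalar ω i j k • x : M)
      map_add' := fun (x y : M) => smul_add (thetaScalar ω i j k) x y
      map_smul' := fun a (x : M) => by
        change (thetaScalar ω i j k • (thetaTwist h i j a • x) : M) =
          thetaTwist h i k a • (thetaScalar ω i j k • x : M)
        rw [← mul_smul, ← mul_smul, thetaScalar_mul h hjk] }

/-- The scalar of the last structure map of `θⁱ(M)`: `ω` if `i = 0`, and `1` otherwise. -/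
def thetaLastScalar (ω : A) (i : Fin n) : A := if i = 0 then ω else 1

theorem thetaLastScalar_mul (i : Fin n) (a : A) :
    thetaLastScalar ω i * thetaTwist h i (lastIdx n) a =
      thetaTwist h i 0 (h.sigma a) * thetaLastScalar ω i := by
  unfold thetaLastScalar thetaTwist
  rw [if_neg (not_lt.mpr (le_lastIdx i))]
  by_cases hi : i = 0
  · rw [if_pos hi, if_neg (by rw [hi]; exact lt_irrefl _)]
    exact (h.sigma_mul a).symm
  · rw [if_neg hi, if_pos (idx_pos hi), one_mul, mul_one]
    exact (h.sigma.symm_apply_apply a).symm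

theorem thetaScalar_total (i j : Fin n) :
    thetaScalar ω i 0 j * (thetaLastScalar ω i * thetaScalar ω i j (lastIdx n)) = thetaTwist h i j ω := by
  have hs : thetaTwist h i j ω = ω := by
    unfold thetaTwist
    split_ifs
    · exact h.left_cancel (h.mul_sigma_symm ω)
    · rfl
  rw [hs]
  unfold thetaScalar thetaLastScalar
  by_cases hi : i = 0
  · subst hi
    simp
  · have h0 : 0 < i := idx_pos hi
    by_cases hj : j < i
    · simp [hi, hj, not_le.mpr hj]
      exact fun c => absurd c (not_lt.mpr (le_lastIdx i))
    · simp [hi, hj, h0, not_lt.mp hj]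

/-- The last structure map `(θⁱ(M))ⁿ⁻¹ ⟶ ^σ((θⁱ(M))⁰)`: on the common underlying group it is
`x ↦ ω x` if `i = 0`, and the identity otherwise. -/
noncomputable def thetaLast (M : ModuleCat.{u} A) (i : Fin n) :
    thetaObj h M i (lastIdx n) ⟶ h.twist.obj (thetaObj h M i 0) :=
  ModuleCat.ofHom (X := thetaObj h M i (lastIdx n)) (Y := h.twist.obj (thetaObj h M i 0))
    { toFun := fun (x : M) => (thetaLastScalar ω i • x : M)
      map_add' := fun (x y : M) => smul_add (thetaLastScalar ω i) x y
      map_smul' := fun a (x : M) => by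
        change (thetaLastScalar ω i • (thetaTwist h i (lastIdx n) a • x) : M) =
          thetaTwist h i 0 (h.sigma a) • (thetaLastScalar ω i • x : M)
        rw [← mul_smul, ← mul_smul, thetaLastScalar_mul h] }

/-- The trivial `n`-fold module factorization
`θⁱ(M) : ^{σ⁻¹}M = ⋯ = ^{σ⁻¹}M --ω--> M = ⋯ = M`, with first copy of `M` in position `i`; for
`i = 0` it is `M = ⋯ = M --ω--> ^σ M`. -/
noncomputable def theta (i : Fin n) (M : ModuleCat.{u} A) : ModFact h n where
  seq :=
    { obj := fun j => thetaObj h M i j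
      map := fun f => thetaMap h M i (leOfHom f)
      map_id := fun j => ModuleCat.hom_ext (LinearMap.ext fun (x : M) => by
        change (thetaScalar ω i j j • x : M) = x
        rw [thetaScalar_self, one_smul])
      map_comp := fun {j k l} f g => ModuleCat.hom_ext (LinearMap.ext fun (x : M) => by
        change (thetaScalar ω i j l • x : M) =
          thetaScalar ω i k l • (thetaScalar ω i j k • x : M)
        rw [← mul_smul, ← thetaScalar_comp (leOfHom f) (leOfHom g)]) }
  last := thetaLast h M i
  comp_eq := fun j => ModuleCat.hom_ext (LinearMap.ext fun (x : M) => by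
    change (thetaScalar ω i 0 j • (thetaLastScalar ω i • (thetaScalar ω i j (lastIdx n) • x : M) : M) : M) =
      (thetaTwist h i j ω • x : M)
    rw [← mul_smul, ← mul_smul, mul_assoc, thetaScalar_total h])

end Theta

/-! ## The matrix ring `Γ_n` -/

/-- The subring `Γ_n` of `M_n(A)` of matrices whose entries below the diagonal lie in `A ω`. -/
def Gamma {A : Type u} [Ring A] {ω : A} (h : IsRegularNormal ω) (n : ℕ) :
    Subring (Matrix (Fin n) (Fin n) A) where
  carrier := {M | ∀ i j : Fin n, j < i → ∃ a : A, M i j = a * ω}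
  zero_mem' := fun i j _ => ⟨0, by simp⟩
  one_mem' := fun i j hij => ⟨0, by simp [Matrix.one_apply_ne (ne_of_gt hij)]⟩
  add_mem' := fun {M N} hM hN i j hij => by
    obtain ⟨a, ha⟩ := hM i j hij
    obtain ⟨b, hb⟩ := hN i j hij
    exact ⟨a + b, by rw [Matrix.add_apply, ha, hb, add_mul]⟩
  neg_mem' := fun {M} hM i j hij => by
    obtain ⟨a, ha⟩ := hM i j hij
    exact ⟨-a, by rw [Matrix.neg_apply, ha, neg_mul]⟩
  mul_mem' := fun {M N} hM hN i j hij => by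
    have key : ∀ k : Fin n, ∃ a : A, M i k * N k j = a * ω := fun k => by
      by_cases hk : k < i
      · obtain ⟨a, ha⟩ := hM i k hk
        obtain ⟨b, hb⟩ := h.exists_left (N k j)
        exact ⟨a * b, by rw [ha, mul_assoc, ← hb, mul_assoc]⟩
      · obtain ⟨a, ha⟩ := hN k j (lt_of_lt_of_le hij (not_lt.mp hk))
        exact ⟨M i k * a, by rw [ha, mul_assoc]⟩
    choose a ha using key
    exact ⟨∑ k, a k, by rw [Matrix.mul_apply, Finset.sum_mul]; simp only [ha]⟩

/-! ## Gorenstein projective objects -/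

section Gorenstein

variable {C : Type v} [Category.{w} C] [Preadditive C]

/-- A totally acyclic complex of projectives: an exact complex `P` of projective objects such that
the complex `Hom(P, Q)` is acyclic for every projective object `Q`. -/
structure IsTotallyAcyclic (P : CochainComplex C ℤ) : Prop where
  projective : ∀ i : ℤ, Projective (P.X i)
  exactAt : ∀ i : ℤ, P.ExactAt i
  hom_acyclic : ∀ Q : C, Projective Q → ∀ (i : ℤ) (f : P.X i ⟶ Q),
    P.d (i - 1) i ≫ f = 0 → ∃ g : P.X (i + 1) ⟶ Q, P.d i (i + 1) ≫ g = f

/-- `G` is Gorenstein projective if it is a kernel of `d⁰` for some totally acyclic complex of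
projectives. -/
def IsGorensteinProjective : ObjectProperty C := fun G =>
  ∃ P : CochainComplex C ℤ, IsTotallyAcyclic P ∧
    ∃ (ι : G ⟶ P.X 0) (z : ι ≫ P.d 0 1 = 0), Nonempty (IsLimit (KernelFork.ofι ι z))

end Gorenstein

/-- `GF_n(A; ω)`: the module factorizations all of whose components are Gorenstein projective
`A`-modules. -/
def GF {A : Type u} [Ring A] {ω : A} (h : IsRegularNormal ω) (n : ℕ) [NeZero n] :
    ObjectProperty (ModFact h n) :=
  fun X => ∀ i : Fin n, IsGorensteinProjective (X.component i)

/-! ## Exact categories and Frobenius categories -/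

section Exact

variable {C : Type v} [Category.{w} C] [Preadditive C]

/-- Admissible monomorphisms with respect to a class `E` of conflations. -/
def IsInflation (E : ObjectProperty (ShortComplex C)) {X Y : C} (i : X ⟶ Y) : Prop :=
  ∃ (Z : C) (p : Y ⟶ Z) (z : i ≫ p = 0), E (ShortComplex.mk i p z)

/-- Admissible epimorphisms with respect to a class `E` of conflations. -/
def IsDeflation (E : ObjectProperty (ShortComplex C)) {Y Z : C} (p : Y ⟶ Z) : Prop :=
  ∃ (X : C) (i : X ⟶ Y) (z : i ≫ p = 0), E (ShortComplex.mk i p z)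

/-- `C` is an additive category and the class `E` of conflations is an exact structure on it in
the sense of Quillen. -/
structure IsExactStructure (E : ObjectProperty (ShortComplex C)) : Prop where
  hasZeroObject : HasZeroObject C
  hasBinaryBiproducts : HasBinaryBiproducts C
  of_iso : ∀ ⦃S T : ShortComplex C⦄, Nonempty (S ≅ T) → E S → E T
  kernel : ∀ S : ShortComplex C, E S → Nonempty (IsLimit (KernelFork.ofι S.f S.zero))
  cokernel : ∀ S : ShortComplex C, E S → Nonempty (IsColimit (CokernelCofork.ofπ S.g S.zero))
  inflation_id : ∀ X : C, IsInflation E (𝟙 X)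
  deflation_id : ∀ X : C, IsDeflation E (𝟙 X)
  inflation_comp : ∀ ⦃X Y Z : C⦄ (i : X ⟶ Y) (j : Y ⟶ Z),
    IsInflation E i → IsInflation E j → IsInflation E (i ≫ j)
  deflation_comp : ∀ ⦃X Y Z : C⦄ (p : X ⟶ Y) (q : Y ⟶ Z),
    IsDeflation E p → IsDeflation E q → IsDeflation E (p ≫ q)
  pushout : ∀ ⦃X Y X' : C⦄ (i : X ⟶ Y) (f : X ⟶ X'), IsInflation E i →
    ∃ (Y' : C) (f' : Y ⟶ Y') (i' : X' ⟶ Y'), IsPushout i f f' i' ∧ IsInflation E i'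
  pullback : ∀ ⦃Y Z Z' : C⦄ (p : Y ⟶ Z) (f : Z' ⟶ Z), IsDeflation E p →
    ∃ (Y' : C) (f' : Y' ⟶ Y) (p' : Y' ⟶ Z'), IsPullback f' p' p f ∧ IsDeflation E p'

/-- Projective objects of an exact category. -/
def IsExactProjective (E : ObjectProperty (ShortComplex C)) (P : C) : Prop :=
  ∀ ⦃Y Z : C⦄ (p : Y ⟶ Z), IsDeflation E p → ∀ f : P ⟶ Z, ∃ g : P ⟶ Y, g ≫ p = f

/-- Injective objects of an exact category. -/
def IsExactInjective (E : ObjectProperty (ShortComplex C)) (I : C) : Prop :=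
  ∀ ⦃X Y : C⦄ (i : X ⟶ Y), IsInflation E i → ∀ f : X ⟶ I, ∃ g : Y ⟶ I, i ≫ g = f

/-- A Frobenius category: an exact category with enough projective and enough injective objects,
in which projective and injective objects coincide. -/
structure IsFrobenius (E : ObjectProperty (ShortComplex C)) : Prop where
  exact : IsExactStructure E
  enough_projectives : ∀ X : C, ∃ (P : C) (p : P ⟶ X), IsExactProjective E P ∧ IsDeflation E p
  enough_injectives : ∀ X : C, ∃ (I : C) (i : X ⟶ I), IsExactInjective E I ∧ IsInflation E i
  projective_iff_injective : ∀ X : C, IsExactProjective E X ↔ IsExactInjective E X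

/-- The conflations of a full subcategory `P` of an (abelian) category: the short exact sequences
with all three terms in `P`. -/
def conflations (P : ObjectProperty C) : ObjectProperty (ShortComplex P.FullSubcategory) :=
  fun S => (S.map P.ι).ShortExact

/-- `X` is a direct summand of `Y`, i.e. `Y` is a biproduct of `X` and some object `Z`. -/
def IsDirectSummand (X Y : C) : Prop :=
  ∃ (Z : C) (b : BinaryBicone X Z), Nonempty b.IsBilimit ∧ Nonempty (b.pt ≅ Y)

end Exact

/-- An equivalence of exact categories: an additive equivalence of categories which preserves and
reflects conflations. -/
def ExactEquivalent {C : Type v} [Category.{w} C] [Preadditive C]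
    {D : Type v} [Category.{w} D] [Preadditive D]
    (E : ObjectProperty (ShortComplex C)) (F : ObjectProperty (ShortComplex D)) : Prop :=
  ∃ (e : C ≌ D) (_ : e.functor.Additive),
    ∀ S : ShortComplex C, E S ↔ F (S.map e.functor)

/-- `X` is a direct summand of `θ⁰(P⁰) ⊕ ⋯ ⊕ θⁿ⁻¹(Pⁿ⁻¹)` for some projective `A`-modules
`P⁰, …, Pⁿ⁻¹`. -/
def IsSummandOfTrivial {A : Type u} [Ring A] {ω : A} {h : IsRegularNormal ω} {n : ℕ} [NeZero n]
    (X : ModFact h n) : Prop :=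
  ∃ P : Fin n → ModuleCat.{u} A, (∀ i, Projective (P i)) ∧
    ∃ b : Bicone (fun i : Fin n => theta h i (P i)), Nonempty b.IsBilimit ∧
      IsDirectSummand X b.pt

end NFold

open scoped ZeroObject

namespace NFold

/-! Two facts drive the proof. First, module factorizations are the same as left `Γ_n`-modules: the
product of the components carries an action in which a matrix entry acts through the transition map
along the cyclic path between two positions (`toGamma`). Hence `ModFact h n` is abelian, and part 2
is invariance of Gorenstein projectivity under additive equivalences, once part 1 is known. Second,
the component functor `ev h i` has adjoints on both sides, and both are given by trivial
factorizations: `θⁱ` is left adjoint to it, and `θⁱ⁺¹` (cyclically, up to a twist) is right adjoint.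
So `ev h i` is exact, it and both adjoints preserve projectives, and the projective factorizations
are exactly the summands of sums of trivial ones on projective modules. For part 1, an exact functor
that preserves projectives and has a right adjoint preserving projectives carries totally acyclic
complexes to totally acyclic ones, so components of Gorenstein projectives are Gorenstein
projective. Conversely, `isGorensteinProjective_of_class` reduces the claim to three properties of
`GF`: Ext¹ into projectives vanishes (by the right adjoints, it can be tested on components), and
every object has a syzygy and a cosyzygy in `GF` (covers by sums of `θⁱ`, embeddings into sums of
the cofree factorizations). Parts 3 and 4 hold for the Gorenstein projectives of any abelian
category: they are closed under extensions, and their relative projectives and relative injectives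
are both the projective objects. -/

theorem exists_int_chain {α : Type*} {R : α → α → Prop} (hr : ∀ x, ∃ y, R x y)
    (hl : ∀ y, ∃ x, R x y) (a : α) :
    ∃ G : ℤ → α, G 0 = a ∧ ∀ i, R (G i) (G (i + 1)) := by
  choose r hr using hr
  choose l hl using hl
  refine ⟨fun i => match i with
    | Int.ofNat k => r^[k] a
    | Int.negSucc k => l^[k + 1] a, rfl, ?_⟩
  rintro (k | k)
  · change R (r^[k] a) (r^[k + 1] a)
    rw [Function.iterate_succ_apply']
    exact hr _
  · rw [show Int.negSucc k + 1 = -(k : ℤ) by rw [Int.negSucc_eq]; ring]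
    cases k with
    | zero => exact hl _
    | succ k =>
      change R (l^[k + 1 + 1] a) (l^[k + 1] a)
      rw [Function.iterate_succ_apply']
      exact hl _

/-! ### Syzygies and vanishing of Ext¹ in an abelian category. -/

section Abelian

variable {C : Type v} [Category.{w} C] [Abelian C]

/-- `K` is a first syzygy of `Y`: there is a short exact sequence `K ⟶ P ⟶ Y` with `P`
projective. -/
def IsSyzygy (K Y : C) : Prop :=
  ∃ (P : C) (i : K ⟶ P) (p : P ⟶ Y) (z : i ≫ p = 0),
    Projective P ∧ (ShortComplex.mk i p z).ShortExact

/-- `Ext¹(Y, Q) = 0`, expressed as an extension property along monomorphisms with cokernel `Y`. -/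
def ExtVanishes (Y Q : C) : Prop :=
  ∀ ⦃K E : C⦄ (i : K ⟶ E) (p : E ⟶ Y) (z : i ≫ p = 0), (ShortComplex.mk i p z).ShortExact →
    ∀ f : K ⟶ Q, ∃ g : E ⟶ Q, i ≫ g = f

/-- `Ext¹(Y, Q) = 0` for all projective objects `Q`. -/
def ExtProjVanishes (Y : C) : Prop := ∀ Q : C, Projective Q → ExtVanishes Y Q

theorem exists_desc {A B D Q : C} {i : A ⟶ B} {p : B ⟶ D} {z : i ≫ p = 0}
    (hS : (ShortComplex.mk i p z).ShortExact) (f : B ⟶ Q) (hf : i ≫ f = 0) :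
    ∃ g : D ⟶ Q, p ≫ g = f := by
  have := hS.epi_g
  exact ⟨hS.exact.desc f hf, hS.exact.g_desc f hf⟩

theorem exists_lift {A B D Q : C} {i : A ⟶ B} {p : B ⟶ D} {z : i ≫ p = 0}
    (hS : (ShortComplex.mk i p z).ShortExact) (f : Q ⟶ B) (hf : f ≫ p = 0) :
    ∃ g : Q ⟶ A, g ≫ i = f := by
  have := hS.mono_f
  exact ⟨hS.exact.lift f hf, hS.exact.lift_f f hf⟩

theorem shortExact_cokernel {A B : C} (i : A ⟶ B) [Mono i] :
    (ShortComplex.mk i (cokernel.π i) (cokernel.condition i)).ShortExact where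
  exact := ShortComplex.exact_cokernel i

theorem shortExact_kernel {A B : C} (p : A ⟶ B) [Epi p] :
    (ShortComplex.mk (kernel.ι p) p (kernel.condition p)).ShortExact where
  exact := ShortComplex.exact_kernel p

/-- It suffices to check the extension property on one projective presentation. -/
theorem extVanishes_of_presentation {K P Y Q : C} {i : K ⟶ P} {p : P ⟶ Y} {z : i ≫ p = 0}
    (hP : Projective P) (hS : (ShortComplex.mk i p z).ShortExact)
    (H : ∀ f : K ⟶ Q, ∃ g : P ⟶ Q, i ≫ g = f) : ExtVanishes Y Q := by
  intro K' E i' p' z' hS' f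
  have e1 : Epi p' := hS'.epi_g
  have e2 : Epi p := hS.epi_g
  have m1 : Mono i' := hS'.mono_f
  let l : P ⟶ E := Projective.factorThru p p'
  have hl : l ≫ p' = p := Projective.factorThru_comp _ _
  obtain ⟨k, hk⟩ := exists_lift hS' (i ≫ l) (by rw [Category.assoc, hl, z])
  obtain ⟨g, hg⟩ := H (k ≫ f)
  -- `E` is the quotient of `P ⊞ K'` by an antidiagonal copy of `K`, embedded by `i` and `-k`. The
  -- map `(g, f)` vanishes on that copy because `g` extends `k ≫ f`, so it descends to `E`.
  let q : P ⊞ K' ⟶ E := biprod.desc l i'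
  have hq : Epi q := by
    refine Preadditive.epi_of_cancel_zero _ fun {T} t ht => ?_
    have h1 : l ≫ t = 0 := by
      have := biprod.inl ≫= ht
      simpa [q] using this
    have h2 : i' ≫ t = 0 := by
      have := biprod.inr ≫= ht
      simpa [q] using this
    obtain ⟨t', rfl⟩ := exists_desc hS' t h2
    have h3 : p ≫ t' = 0 := by rw [← hl, Category.assoc, h1]
    rw [(cancel_epi p).1 (h3.trans comp_zero.symm), comp_zero]
  have hz : kernel.ι q ≫ biprod.desc g f = 0 := by
    set a := kernel.ι q ≫ biprod.fst with ha
    set b := kernel.ι q ≫ biprod.snd with hb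
    have hdec : kernel.ι q = a ≫ biprod.inl + b ≫ biprod.inr := by
      rw [ha, hb, Category.assoc, Category.assoc, ← Preadditive.comp_add, biprod.total,
        Category.comp_id]
    have h0 : a ≫ l + b ≫ i' = 0 := by
      have := kernel.condition q
      rw [hdec] at this
      simpa [q] using this
    have h1 : a ≫ p = 0 := by
      have := h0 =≫ p'
      simpa [hl, z'] using this
    obtain ⟨c, hc⟩ := exists_lift hS a h1
    have h2 : c ≫ k + b = 0 := by
      rw [← cancel_mono i', Preadditive.add_comp, Category.assoc, hk, ← Category.assoc, hc, h0,
        zero_comp]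
    rw [hdec, Preadditive.add_comp, Category.assoc a, Category.assoc b, biprod.inl_desc,
      biprod.inr_desc, ← hc, Category.assoc, hg, ← Category.assoc, ← Preadditive.add_comp, h2,
      zero_comp]
  obtain ⟨e, he⟩ := exists_desc (shortExact_kernel q) (biprod.desc g f) hz
  refine ⟨e, ?_⟩
  have := biprod.inr ≫= he
  simpa [q] using this

theorem ExtVanishes.of_retract {Y Q Q' : C} (h : ExtVanishes Y Q) (r : Retract Q' Q) :
    ExtVanishes Y Q' := by
  intro K E i p z hS f
  obtain ⟨g, hg⟩ := h i p z hS (f ≫ r.i)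
  exact ⟨g ≫ r.r, by rw [← Category.assoc, hg, Category.assoc, r.retract, Category.comp_id]⟩

theorem ExtVanishes.biproduct {J : Type*} {Y : C} {F : J → C} [HasBiproduct F]
    (h : ∀ j, ExtVanishes Y (F j)) : ExtVanishes Y (⨁ F) := by
  intro K E i p z hS f
  choose g hg using fun j => h j i p z hS (f ≫ biproduct.π F j)
  refine ⟨biproduct.lift g, biproduct.hom_ext _ _ fun j => ?_⟩
  rw [Category.assoc, biproduct.lift_π, hg]

theorem ExtVanishes.of_iso {Y Y' Q : C} (h : ExtVanishes Y Q) (e : Y ≅ Y') :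
    ExtVanishes Y' Q := by
  intro K E i p z hS f
  refine h i (p ≫ e.inv) (by rw [← Category.assoc, z, zero_comp]) ?_ f
  exact ShortComplex.shortExact_of_iso (S₁ := ShortComplex.mk i p z)
    (ShortComplex.isoMk (Iso.refl _) (Iso.refl _) e.symm) hS

theorem IsSyzygy.of_iso {K Y K' Y' : C} (h : IsSyzygy K Y) (e : K ≅ K') (e' : Y ≅ Y') :
    IsSyzygy K' Y' := by
  obtain ⟨P, i, p, z, hP, hS⟩ := h
  refine ⟨P, e.inv ≫ i, p ≫ e'.hom, by rw [Category.assoc, reassoc_of% z]; simp, hP, ?_⟩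
  exact ShortComplex.shortExact_of_iso (S₁ := ShortComplex.mk i p z)
    (ShortComplex.isoMk e (Iso.refl _) e') hS

/-! ### Kernels and cokernels of compositions -/

/-- This and the next three statements are pieces of the six-term exact sequence ker f, ker fg, ker
g, coker f, coker fg, coker g. In each case the hypotheses annihilate the terms adjacent to the
three that remain. -/
theorem shortExact_cokernel_comp {X Y Z : C} (f : X ⟶ Y) (g : Y ⟶ Z) [Mono g] :
    (ShortComplex.mk (cokernel.map f (f ≫ g) (𝟙 _) g (by simp))
      (cokernel.map (f ≫ g) g f (𝟙 _) (by simp))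
      ((kernelCokernelCompSequence.snakeInput f g).L₃.zero)).ShortExact where
  exact := (kernelCokernelCompSequence_exact f g).exact 3
  mono_f := ((kernelCokernelCompSequence_exact f g).exact 2).mono_g
    ((isZero_kernel_of_mono g).eq_of_src _ _)
  epi_g := inferInstanceAs (Epi ((kernelCokernelCompSequence f g).map' 4 5))

theorem shortExact_kernel_comp {X Y Z : C} (f : X ⟶ Y) (g : Y ⟶ Z) [Epi f] :
    (ShortComplex.mk (kernel.map f (f ≫ g) (𝟙 _) g (by simp))
      (kernel.map (f ≫ g) g f (𝟙 _) (by simp))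
      ((kernelCokernelCompSequence.snakeInput f g).L₀.zero)).ShortExact where
  exact := (kernelCokernelCompSequence_exact f g).exact 0
  mono_f := inferInstanceAs (Mono ((kernelCokernelCompSequence f g).map' 0 1))
  epi_g := ((kernelCokernelCompSequence_exact f g).exact 1).epi_f
    ((isZero_cokernel_of_epi f).eq_of_tgt _ _)

theorem exists_shortExact_kernel_cokernel_cokernel {X Y Z : C} (f : X ⟶ Y) (g : Y ⟶ Z)
    [Epi g] [Mono (f ≫ g)] :
    ∃ (a : kernel g ⟶ cokernel f) (b : cokernel f ⟶ cokernel (f ≫ g)) (z : a ≫ b = 0),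
      (ShortComplex.mk a b z).ShortExact :=
  ⟨_, _, _,
    { exact := (kernelCokernelCompSequence_exact f g).exact 2
      mono_f := ((kernelCokernelCompSequence_exact f g).exact 1).mono_g
        ((isZero_kernel_of_mono (f ≫ g)).eq_of_src _ _)
      epi_g := ((kernelCokernelCompSequence_exact f g).exact 3).epi_f
        ((isZero_cokernel_of_epi g).eq_of_tgt _ _) }⟩

theorem exists_shortExact_kernel_kernel_cokernel {X Y Z : C} (f : X ⟶ Y) (g : Y ⟶ Z)
    [Mono f] [Epi (f ≫ g)] :
    ∃ (a : kernel (f ≫ g) ⟶ kernel g) (b : kernel g ⟶ cokernel f) (z : a ≫ b = 0),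
      (ShortComplex.mk a b z).ShortExact :=
  ⟨_, _, _,
    { exact := (kernelCokernelCompSequence_exact f g).exact 1
      mono_f := ((kernelCokernelCompSequence_exact f g).exact 0).mono_g
        ((isZero_kernel_of_mono f).eq_of_src _ _)
      epi_g := ((kernelCokernelCompSequence_exact f g).exact 2).epi_f
        ((isZero_cokernel_of_epi (f ≫ g)).eq_of_tgt _ _) }⟩

theorem shortExact_of_lift {A B D : C} {i : A ⟶ B} {p : B ⟶ D} (z : i ≫ p = 0) (hi : Mono i)
    (hp : Epi p) (H : ∀ (T : C) (k : T ⟶ B), k ≫ p = 0 → ∃ l : T ⟶ A, l ≫ i = k) :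
    (ShortComplex.mk i p z).ShortExact where
  exact := ShortComplex.exact_of_f_is_kernel _
    (KernelFork.IsLimit.ofι' _ _ fun {T} k hk => ⟨(H T k hk).choose, (H T k hk).choose_spec⟩)

theorem shortExact_of_desc {A B D : C} {i : A ⟶ B} {p : B ⟶ D} (z : i ≫ p = 0) (hi : Mono i)
    (hp : Epi p) (H : ∀ (T : C) (k : B ⟶ T), i ≫ k = 0 → ∃ l : D ⟶ T, p ≫ l = k) :
    (ShortComplex.mk i p z).ShortExact where
  exact := ShortComplex.exact_of_g_is_cokernel _
    (CokernelCofork.IsColimit.ofπ' _ _ fun {T} k hk =>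
      ⟨(H T k hk).choose, (H T k hk).choose_spec⟩)

/-! ### A recognition criterion for Gorenstein projective objects -/

/-- Syzygies and cosyzygies chosen inside the class give short exact sequences `G n ⟶ P n ⟶ G (n +
1)` for all integers `n`. Splicing them yields an exact complex of projectives, and `hext` makes it
totally acyclic. All later proofs of Gorenstein projectivity from syzygies go through this
criterion. -/
theorem isGorensteinProjective_of_class {𝒢 : ObjectProperty C}
    (hr : ∀ x, 𝒢 x → ∃ y, 𝒢 y ∧ IsSyzygy x y) (hl : ∀ y, 𝒢 y → ∃ x, 𝒢 x ∧ IsSyzygy x y)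
    (hext : ∀ x, 𝒢 x → ExtProjVanishes x) (x : C) (hx : 𝒢 x) : IsGorensteinProjective x := by
  obtain ⟨G, hG0, hG⟩ := exists_int_chain (α := {x // 𝒢 x})
    (R := fun x y => IsSyzygy x.1 y.1)
    (fun x => by obtain ⟨y, hy, h⟩ := hr x.1 x.2; exact ⟨⟨y, hy⟩, h⟩)
    (fun y => by obtain ⟨x, hx, h⟩ := hl y.1 y.2; exact ⟨⟨x, hx⟩, h⟩) ⟨x, hx⟩
  choose P i p z hP hS using hG
  have hm : ∀ n, Mono (i n) := fun n => (hS n).mono_f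
  have he : ∀ n, Epi (p n) := fun n => (hS n).epi_g
  let K : CochainComplex C ℤ := CochainComplex.of P (fun n => p n ≫ i (n + 1)) (fun n => by
    rw [Category.assoc, ← Category.assoc (i _), z, zero_comp, comp_zero])
  have hd : ∀ n, K.d n (n + 1) = p n ≫ i (n + 1) := fun n => CochainComplex.of_d P (fun n => p n ≫ i (n + 1)) n
  obtain rfl : x = (G 0).1 := by rw [hG0]
  refine ⟨K, ⟨hP, fun n => ?_, fun Q hQ n f hf => ?_⟩, i 0, ?_, ⟨?_⟩⟩
  · obtain ⟨m, rfl⟩ : ∃ m, n = m + 1 := ⟨n - 1, by ring⟩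
    rw [HomologicalComplex.exactAt_iff' K m (m + 1) (m + 1 + 1) (by simp) (by simp)]
    have := (hS (m + 1)).exact
    let S := ShortComplex.mk (p m ≫ i (m + 1)) (p (m + 1) ≫ i (m + 1 + 1)) (by
      rw [Category.assoc, ← Category.assoc (i _), z, zero_comp, comp_zero])
    -- Exactness in the middle survives precomposing the first map with the epimorphism `p m` and
    -- postcomposing the second with the monomorphism `i (m + 1 + 1)`.
    have hS' : S.Exact := by
      let φ : S ⟶ ShortComplex.mk (i (m + 1)) (p (m + 1) ≫ i (m + 1 + 1))
          (by rw [← Category.assoc, z, zero_comp]) :=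
        { τ₁ := p m, τ₂ := 𝟙 _, τ₃ := 𝟙 _ }
      let ψ : ShortComplex.mk (i (m + 1)) (p (m + 1)) (z _) ⟶
          ShortComplex.mk (i (m + 1)) (p (m + 1) ≫ i (m + 1 + 1))
          (by rw [← Category.assoc, z, zero_comp]) :=
        { τ₁ := 𝟙 _, τ₂ := 𝟙 _, τ₃ := i (m + 1 + 1) }
      have : Epi φ.τ₁ := he m
      have : IsIso φ.τ₂ := inferInstanceAs (IsIso (𝟙 _))
      have : Mono φ.τ₃ := inferInstanceAs (Mono (𝟙 _))
      have : Epi ψ.τ₁ := inferInstanceAs (Epi (𝟙 _))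
      have : IsIso ψ.τ₂ := inferInstanceAs (IsIso (𝟙 _))
      have : Mono ψ.τ₃ := hm _
      rw [ShortComplex.exact_iff_of_epi_of_isIso_of_mono φ,
        ← ShortComplex.exact_iff_of_epi_of_isIso_of_mono ψ]
      exact (hS (m + 1)).exact
    exact ShortComplex.exact_of_iso (S₁ := S) (S₂ := K.sc' m (m + 1) (m + 1 + 1))
      (ShortComplex.isoMk (Iso.refl (P m)) (Iso.refl (P (m + 1))) (Iso.refl (P (m + 1 + 1)))
      ((Category.id_comp _).trans ((hd m).trans (Category.comp_id _).symm))
      ((Category.id_comp _).trans ((hd (m + 1)).trans (Category.comp_id _).symm))) hS'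
  · obtain ⟨m, rfl⟩ : ∃ m, n = m + 1 := ⟨n - 1, by ring⟩
    rw [add_sub_cancel_right, hd, Category.assoc] at hf
    -- A cocycle on `P (m + 1)` factors through `G (m + 2)`, and vanishing of Ext¹ for `G (m + 3)`
    -- extends the factor to `P (m + 2)`.
    obtain ⟨f', hf'⟩ := exists_desc (hS (m + 1)) f ((cancel_epi (p m)).1 (hf.trans comp_zero.symm))
    obtain ⟨g, hg⟩ := hext _ (G (m + 1 + 1 + 1)).2 Q hQ _ _ _ (hS (m + 1 + 1)) f'
    refine ⟨g, ?_⟩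
    rw [hd, Category.assoc, hg, hf']
  · rw [show K.d 0 1 = p 0 ≫ i (0 + 1) from hd 0, ← Category.assoc, z, zero_comp]
  · refine KernelFork.IsLimit.ofι' _ _ fun {A} k hk => ?_
    have hk' : k ≫ p 0 = 0 := by
      have h1 : K.d 0 1 = p 0 ≫ i (0 + 1) := hd 0
      rw [h1, ← Category.assoc] at hk
      exact (cancel_mono (i (0 + 1))).1 (hk.trans zero_comp.symm)
    exact ⟨(exists_lift (hS 0) k hk').choose, (exists_lift (hS 0) k hk').choose_spec⟩

/-! ### Cycles of totally acyclic complexes -/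

theorem IsTotallyAcyclic.epi_lift {P : CochainComplex C ℤ} (hP : IsTotallyAcyclic P) (j : ℤ) :
    Epi (kernel.lift (P.d (j + 1) (j + 1 + 1)) (P.d j (j + 1)) (P.d_comp_d _ _ _)) := by
  have h := hP.exactAt (j + 1)
  rw [HomologicalComplex.exactAt_iff' P j (j + 1) (j + 1 + 1) (by simp) (by simp)] at h
  exact h.epi_kernelLift

theorem IsTotallyAcyclic.shortExact {P : CochainComplex C ℤ} (hP : IsTotallyAcyclic P) (j : ℤ) :
    (ShortComplex.mk (kernel.ι (P.d j (j + 1)))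
      (kernel.lift (P.d (j + 1) (j + 1 + 1)) (P.d j (j + 1)) (P.d_comp_d _ _ _))
      (by rw [← cancel_mono (kernel.ι _)]; simp)).ShortExact where
  exact := by
    refine ShortComplex.exact_of_f_is_kernel _ (KernelFork.IsLimit.ofι' _ _ fun {A} k hk => ?_)
    exact ⟨kernel.lift _ k (by
      have := hk =≫ kernel.ι _
      simpa using this), by simp⟩
  epi_g := hP.epi_lift j

/-- A map to `Q` from the preceding cycle object, pulled back along the projective covering it, is a
cocycle of `Hom(P, Q)`. Acyclicity makes it a coboundary, which is the extension sought. One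
presentation suffices by `extVanishes_of_presentation`. -/
theorem IsTotallyAcyclic.extProjVanishes {P : CochainComplex C ℤ} (hP : IsTotallyAcyclic P)
    (j : ℤ) : ExtProjVanishes (kernel (P.d j (j + 1))) := by
  obtain ⟨k, rfl⟩ : ∃ k, j = k + 1 + 1 := ⟨j - 2, by ring⟩
  intro Q hQ
  refine extVanishes_of_presentation (hP.projective _) (hP.shortExact (k + 1)) fun f => ?_
  have := hP.epi_lift k
  obtain ⟨m, rfl⟩ : ∃ m, k = m + 1 := ⟨k - 1, by ring⟩
  obtain ⟨g, hg⟩ := hP.hom_acyclic Q hQ (m + 1) (kernel.lift _ (P.d _ _) (P.d_comp_d _ _ _) ≫ f) (by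
    rw [add_sub_cancel_right, ← Category.assoc]
    have : P.d m (m + 1) ≫ kernel.lift (P.d (m + 1 + 1) (m + 1 + 1 + 1))
      (P.d (m + 1) (m + 1 + 1)) (P.d_comp_d _ _ _) = 0 := by
      rw [← cancel_mono (kernel.ι _)]; simp
    rw [this, zero_comp])
  refine ⟨g, ?_⟩
  rw [← cancel_epi (kernel.lift (P.d (m + 1 + 1) (m + 1 + 1 + 1))
      (P.d (m + 1) (m + 1 + 1)) (P.d_comp_d _ _ _)), ← hg, ← Category.assoc, kernel.lift_ι]

/-- The objects isomorphic to some cycle object of some totally acyclic complex. -/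
def IsTotallyAcyclicCycle : ObjectProperty C := fun x =>
  ∃ (P : CochainComplex C ℤ) (_ : IsTotallyAcyclic P) (j : ℤ),
    Nonempty (kernel (P.d j (j + 1)) ≅ x)

theorem IsGorensteinProjective.cycle {x : C} (hx : IsGorensteinProjective x) :
    IsTotallyAcyclicCycle x := by
  obtain ⟨P, hP, i, z, ⟨hl⟩⟩ := hx
  exact ⟨P, hP, 0, ⟨IsLimit.conePointUniqueUpToIso (kernelIsKernel _) hl⟩⟩

theorem IsTotallyAcyclicCycle.exists_cosyzygy {x : C} (hx : IsTotallyAcyclicCycle x) :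
    ∃ y, IsTotallyAcyclicCycle y ∧ IsSyzygy x y := by
  obtain ⟨P, hP, j, ⟨e⟩⟩ := hx
  exact ⟨_, ⟨P, hP, j + 1, ⟨Iso.refl _⟩⟩,
    IsSyzygy.of_iso ⟨_, _, _, _, hP.projective j, hP.shortExact j⟩ e (Iso.refl _)⟩

theorem IsTotallyAcyclicCycle.exists_syzygy {y : C} (hy : IsTotallyAcyclicCycle y) :
    ∃ x, IsTotallyAcyclicCycle x ∧ IsSyzygy x y := by
  obtain ⟨P, hP, j, ⟨e⟩⟩ := hy
  obtain ⟨k, rfl⟩ : ∃ k, j = k + 1 := ⟨j - 1, by ring⟩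
  exact ⟨_, ⟨P, hP, k, ⟨Iso.refl _⟩⟩,
    IsSyzygy.of_iso ⟨_, _, _, _, hP.projective k, hP.shortExact k⟩ (Iso.refl _) e⟩

theorem IsTotallyAcyclicCycle.extProjVanishes {x : C} (hx : IsTotallyAcyclicCycle x) :
    ExtProjVanishes x := by
  obtain ⟨P, hP, j, ⟨e⟩⟩ := hx
  exact fun Q hQ => (hP.extProjVanishes j Q hQ).of_iso e

/-- The definition of Gorenstein projective singles out degree 0. The recognition criterion, applied
to cycles of all degrees at once, removes this restriction without shifting complexes. -/
theorem IsTotallyAcyclicCycle.isGorensteinProjective {x : C} (hx : IsTotallyAcyclicCycle x) :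
    IsGorensteinProjective x :=
  isGorensteinProjective_of_class (fun _ h => h.exists_cosyzygy) (fun _ h => h.exists_syzygy)
    (fun _ h => h.extProjVanishes) x hx

namespace IsGorensteinProjective

theorem of_iso {x y : C} (hx : IsGorensteinProjective x) (e : x ≅ y) :
    IsGorensteinProjective y := by
  obtain ⟨P, hP, j, ⟨e'⟩⟩ := hx.cycle
  exact IsTotallyAcyclicCycle.isGorensteinProjective ⟨P, hP, j, ⟨e' ≪≫ e⟩⟩

theorem exists_cosyzygy {x : C} (hx : IsGorensteinProjective x) :
    ∃ y, IsGorensteinProjective y ∧ IsSyzygy x y := by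
  obtain ⟨y, hy, h⟩ := hx.cycle.exists_cosyzygy
  exact ⟨y, hy.isGorensteinProjective, h⟩

theorem exists_syzygy {y : C} (hy : IsGorensteinProjective y) :
    ∃ x, IsGorensteinProjective x ∧ IsSyzygy x y := by
  obtain ⟨x, hx, h⟩ := hy.cycle.exists_syzygy
  exact ⟨x, hx.isGorensteinProjective, h⟩

theorem extProjVanishes {x : C} (hx : IsGorensteinProjective x) : ExtProjVanishes x :=
  hx.cycle.extProjVanishes

end IsGorensteinProjective

instance : (IsGorensteinProjective (C := C)).IsClosedUnderIsomorphisms where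
  of_iso e h := h.of_iso e

theorem shortExact_zero_id (Y : C) :
    (ShortComplex.mk (0 : (0 : C) ⟶ Y) (𝟙 Y) (by simp)).ShortExact where
  exact := by
    rw [ShortComplex.exact_iff_mono _ rfl]
    exact inferInstanceAs (Mono (𝟙 Y))
  mono_f := ⟨fun _ _ _ => (isZero_zero C).eq_of_tgt _ _⟩
  epi_g := inferInstanceAs (Epi (𝟙 Y))

theorem shortExact_id_zero (Y : C) :
    (ShortComplex.mk (𝟙 Y) (0 : Y ⟶ (0 : C)) (by simp)).ShortExact where
  exact := by
    rw [ShortComplex.exact_iff_epi _ rfl]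
    exact inferInstanceAs (Epi (𝟙 Y))
  mono_f := inferInstanceAs (Mono (𝟙 Y))
  epi_g := ⟨fun _ _ _ => (isZero_zero C).eq_of_src _ _⟩

theorem extVanishes_of_projective {Y : C} (hY : Projective Y) (Q : C) : ExtVanishes Y Q :=
  extVanishes_of_presentation (i := (0 : (0 : C) ⟶ Y)) (p := 𝟙 Y) (z := by simp) hY
    (shortExact_zero_id Y)
    fun _ => ⟨0, (isZero_zero C).eq_of_src _ _⟩

theorem _root_.CategoryTheory.Projective.isGorensteinProjective {Y : C} (hY : Projective Y) :
    IsGorensteinProjective Y :=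
  isGorensteinProjective_of_class (𝒢 := fun Y => Projective Y)
    (fun x hx => ⟨0, inferInstance, x, _, _, _, hx, shortExact_id_zero x⟩)
    (fun x hx => ⟨0, inferInstance, x, _, _, _, hx, shortExact_zero_id x⟩)
    (fun _ hx Q _ => extVanishes_of_projective hx Q) Y hY

/-- The third isomorphism theorem for `A ⊆ B ⊆ E`, with `D`, `F` and `W` in the roles of `B/A`,
`E/B` and `E/A`. -/
theorem shortExact_comp_of_mono {A B D E F : C} {u : A ⟶ B} {π : B ⟶ D} {z : u ≫ π = 0}
    (hS : (ShortComplex.mk u π z).ShortExact) {j : B ⟶ E} {ρ : E ⟶ F} {z' : j ≫ ρ = 0}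
    (hT : (ShortComplex.mk j ρ z').ShortExact) :
    ∃ (W : C) (q : E ⟶ W) (z'' : (u ≫ j) ≫ q = 0),
      (ShortComplex.mk (u ≫ j) q z'').ShortExact ∧
      ∃ (s : D ⟶ W) (t : W ⟶ F) (y : s ≫ t = 0), (ShortComplex.mk s t y).ShortExact := by
  have : Mono u := hS.mono_f
  have : Mono j := hT.mono_f
  let e₁ : cokernel u ≅ D := (cokernelIsCokernel u).coconePointUniqueUpToIso hS.gIsCokernel
  let e₂ : cokernel j ≅ F := (cokernelIsCokernel j).coconePointUniqueUpToIso hT.gIsCokernel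
  refine ⟨_, _, _, shortExact_cokernel (u ≫ j),
    e₁.inv ≫ cokernel.map u (u ≫ j) (𝟙 _) j (by simp),
    cokernel.map (u ≫ j) j u (𝟙 _) (by simp) ≫ e₂.hom, ?_, ?_⟩
  · have : cokernel.map u (u ≫ j) (𝟙 _) j (by simp) ≫
        cokernel.map (u ≫ j) j u (𝟙 _) (by simp) = 0 := by
      rw [← cancel_epi (cokernel.π u)]
      simp
    rw [Category.assoc, reassoc_of% this, zero_comp, comp_zero]
  · exact ShortComplex.shortExact_of_iso
      (S₁ := ShortComplex.mk _ _
        (kernelCokernelCompSequence.snakeInput u j).L₃.zero)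
      (ShortComplex.isoMk e₁ (Iso.refl _) e₂
      (by simp [kernelCokernelCompSequence.snakeInput])
      (by simp [kernelCokernelCompSequence.snakeInput])) (shortExact_cokernel_comp u j)

theorem shortExact_comp_of_epi {A B D E F : C} {p : A ⟶ B} {u : D ⟶ A} {z : u ≫ p = 0}
    (hS : (ShortComplex.mk u p z).ShortExact) {q : B ⟶ E} {j : F ⟶ B} {z' : j ≫ q = 0}
    (hT : (ShortComplex.mk j q z').ShortExact) :
    ∃ (W : C) (i : W ⟶ A) (z'' : i ≫ p ≫ q = 0),
      (ShortComplex.mk i (p ≫ q) z'').ShortExact ∧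
      ∃ (s : D ⟶ W) (t : W ⟶ F) (y : s ≫ t = 0), (ShortComplex.mk s t y).ShortExact := by
  have : Epi p := hS.epi_g
  have : Epi q := hT.epi_g
  let e₁ : kernel p ≅ D := (kernelIsKernel p).conePointUniqueUpToIso hS.fIsKernel
  let e₂ : kernel q ≅ F := (kernelIsKernel q).conePointUniqueUpToIso hT.fIsKernel
  refine ⟨_, _, _, shortExact_kernel (p ≫ q),
    e₁.inv ≫ kernel.map p (p ≫ q) (𝟙 _) q (by simp),
    kernel.map (p ≫ q) q p (𝟙 _) (by simp) ≫ e₂.hom, ?_, ?_⟩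
  · have : kernel.map p (p ≫ q) (𝟙 _) q (by simp) ≫
        kernel.map (p ≫ q) q p (𝟙 _) (by simp) = 0 := by
      rw [← cancel_mono (kernel.ι q)]
      simp
    rw [Category.assoc, reassoc_of% this, zero_comp, comp_zero]
  · exact ShortComplex.shortExact_of_iso
      (S₁ := ShortComplex.mk _ _
        (kernelCokernelCompSequence.snakeInput p q).L₀.zero)
      (ShortComplex.isoMk e₁ (Iso.refl _) e₂
      (by simp [kernelCokernelCompSequence.snakeInput])
      (by simp [kernelCokernelCompSequence.snakeInput])) (shortExact_kernel_comp p q)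

theorem shortExact_pushout {X Y Z X' : C} {i : X ⟶ Y} {p : Y ⟶ Z} {z : i ≫ p = 0}
    (hS : (ShortComplex.mk i p z).ShortExact) (f : X ⟶ X') :
    ∃ (p' : pushout i f ⟶ Z) (z' : pushout.inr i f ≫ p' = 0), pushout.inl i f ≫ p' = p ∧
      (ShortComplex.mk (pushout.inr i f) p' z').ShortExact := by
  have : Mono i := hS.mono_f
  have hp : Epi p := hS.epi_g
  let p' : pushout i f ⟶ Z := pushout.desc p 0 (by rw [z, comp_zero])
  have h1 : pushout.inl i f ≫ p' = p := pushout.inl_desc _ _ _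
  refine ⟨p', pushout.inr_desc _ _ _, h1, ?_⟩
  have hp' : Epi p' := by
    have : Epi (pushout.inl i f ≫ p') := by rw [h1]; exact hp
    exact epi_of_epi (pushout.inl i f) p'
  refine shortExact_of_desc _ inferInstance hp' fun A k hk => ?_
  obtain ⟨l, hl⟩ := exists_desc hS (pushout.inl i f ≫ k) (by
    rw [pushout.condition_assoc, hk, comp_zero])
  refine ⟨l, pushout.hom_ext ?_ ?_⟩
  · rw [← Category.assoc, h1, hl]
  · rw [← Category.assoc, pushout.inr_desc, zero_comp, hk]

theorem shortExact_pullback {X Y Z Z' : C} {i : X ⟶ Y} {p : Y ⟶ Z} {z : i ≫ p = 0}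
    (hS : (ShortComplex.mk i p z).ShortExact) (f : Z' ⟶ Z) :
    ∃ (i' : X ⟶ pullback p f) (z' : i' ≫ pullback.snd p f = 0), i' ≫ pullback.fst p f = i ∧
      (ShortComplex.mk i' (pullback.snd p f) z').ShortExact := by
  have hi : Mono i := hS.mono_f
  have : Epi p := hS.epi_g
  let i' : X ⟶ pullback p f := pullback.lift i 0 (by rw [z, zero_comp])
  have h1 : i' ≫ pullback.fst p f = i := pullback.lift_fst _ _ _
  refine ⟨i', pullback.lift_snd _ _ _, h1, ?_⟩
  have hi' : Mono i' := by
    have : Mono (i' ≫ pullback.fst p f) := by rw [h1]; exact hi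
    exact mono_of_mono i' (pullback.fst p f)
  refine shortExact_of_lift _ hi' inferInstance fun A k hk => ?_
  obtain ⟨l, hl⟩ := exists_lift hS (k ≫ pullback.fst p f) (by
    rw [Category.assoc, pullback.condition, ← Category.assoc, hk, zero_comp])
  refine ⟨l, pullback.hom_ext ?_ ?_⟩
  · rw [Category.assoc, h1, hl]
  · rw [Category.assoc, pullback.lift_snd, comp_zero, hk]

/-! ### Gorenstein projective objects are closed under extensions -/

/-- No long exact sequence is needed. With `W` the preimage of `X` in `E`, a map on `K` extends to
`W` because `W/K` is `X`, and then to `E` because `E/W` is `Z`. -/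
theorem ExtVanishes.of_shortExact {X Y Z Q : C} {i : X ⟶ Y} {p : Y ⟶ Z} {z : i ≫ p = 0}
    (hS : (ShortComplex.mk i p z).ShortExact) (hX : ExtVanishes X Q) (hZ : ExtVanishes Z Q) :
    ExtVanishes Y Q := by
  intro K E j q w hT f
  obtain ⟨W, a, wa, hW, s, t, y, hst⟩ := shortExact_comp_of_epi hT hS
  have : Mono a := hW.mono_f
  have e₁ : Epi q := hT.epi_g
  -- The sequence `s`, `t` comes with no compatibility with `j` and `q`, so the maps `K ⟶ W ⟶ X` are
  -- rebuilt as `b` and `c`.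
  obtain ⟨b, hb⟩ := exists_lift hW j (by rw [← Category.assoc, w, zero_comp])
  obtain ⟨c, hc⟩ := exists_lift hS (a ≫ q) (by rw [Category.assoc, wa])
  have hbc : b ≫ c = 0 := by
    have : Mono i := hS.mono_f
    rw [← cancel_mono i, Category.assoc, hc, ← Category.assoc, hb, w, zero_comp]
  have hex : (ShortComplex.mk b c hbc).ShortExact := by
    have hb' : Mono b := by
      have : Mono (b ≫ a) := by rw [hb]; exact hT.mono_f
      exact mono_of_mono b a
    refine shortExact_of_lift _ hb' ?_ fun A k hk => ?_
    -- The pullback of `q` along `i` surjects onto `X` and factors through `c`, so `c` is an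
    -- epimorphism.
    · let m : pullback q i ⟶ E := pullback.fst q i
      obtain ⟨l, hl⟩ := exists_lift hW m (by
        rw [← Category.assoc, pullback.condition, Category.assoc, z, comp_zero])
      have : l ≫ c = pullback.snd q i := by
        have : Mono i := hS.mono_f
        rw [← cancel_mono i, Category.assoc, hc, ← Category.assoc, hl, pullback.condition]
      have h3 : Epi (l ≫ c) := by rw [this]; infer_instance
      exact epi_of_epi l c
    · obtain ⟨l, hl⟩ := exists_lift hT (k ≫ a) (by
        rw [Category.assoc, ← hc, ← Category.assoc, hk, zero_comp])
      exact ⟨l, by rw [← cancel_mono a, Category.assoc, hb, hl]⟩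
  obtain ⟨g, hg⟩ := hX b c hbc hex f
  obtain ⟨h, hh⟩ := hZ a (q ≫ p) wa hW g
  exact ⟨h, by rw [← hb, Category.assoc, hh, hg]⟩

theorem IsSyzygy.biprod_right {K Y Q : C} (hQ : Projective Q) (h : IsSyzygy K Y) :
    IsSyzygy (Q ⊞ K) Y := by
  obtain ⟨P, i, p, z, hP, hS⟩ := h
  have : Mono i := hS.mono_f
  have : Epi p := hS.epi_g
  refine ⟨Q ⊞ P, biprod.map (𝟙 Q) i, biprod.snd ≫ p, by simp [z], inferInstance,
    shortExact_of_lift _ inferInstance inferInstance fun A k hk => ?_⟩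
  obtain ⟨l, hl⟩ := exists_lift hS (k ≫ biprod.snd) (by rw [Category.assoc, hk])
  exact ⟨biprod.lift (k ≫ biprod.fst) l, biprod.hom_ext _ _ (by simp) (by simp [hl])⟩

theorem IsSyzygy.biprod_left {K Y Q : C} (hQ : Projective Q) (h : IsSyzygy K Y) :
    IsSyzygy K (Q ⊞ Y) := by
  obtain ⟨P, i, p, z, hP, hS⟩ := h
  have : Mono i := hS.mono_f
  have : Epi p := hS.epi_g
  refine ⟨Q ⊞ P, i ≫ biprod.inr, biprod.map (𝟙 Q) p, by simp [reassoc_of% z], inferInstance,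
    shortExact_of_lift _ inferInstance inferInstance fun A k hk => ?_⟩
  have h1 : k ≫ biprod.fst = 0 := by
    have := hk =≫ biprod.fst
    simpa using this
  obtain ⟨l, hl⟩ := exists_lift hS (k ≫ biprod.snd) (by
    have := hk =≫ biprod.snd
    simpa using this)
  exact ⟨l, biprod.hom_ext _ _ (by simp [h1]) (by simp [hl])⟩

/-- A short exact sequence `X ⟶ Y ⟶ Z` with `Ext¹(Z, X) = 0` exhibits `Y` as `X ⊞ Z`. -/
theorem nonempty_iso_biprod {X Y Z : C} {i : X ⟶ Y} {p : Y ⟶ Z} {z : i ≫ p = 0}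
    (hS : (ShortComplex.mk i p z).ShortExact) (hZ : ExtVanishes Z X) :
    Nonempty (X ⊞ Z ≅ Y) := by
  obtain ⟨r, hr⟩ := hZ i p z hS (𝟙 X)
  let s := ShortComplex.Splitting.ofExactOfRetraction _ hS.exact r hr hS.epi_g
  exact ⟨(s.isoBinaryBiproduct).symm⟩

/-- The class of all extensions of Gorenstein projectives satisfies the recognition criterion. This
is a horseshoe argument: the cosyzygy of an extension is an extension of cosyzygies, and likewise
for syzygies. -/
theorem IsGorensteinProjective.of_shortExact {X Y Z : C} {i : X ⟶ Y} {p : Y ⟶ Z}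
    {z : i ≫ p = 0} (hS : (ShortComplex.mk i p z).ShortExact) (hX : IsGorensteinProjective X)
    (hZ : IsGorensteinProjective Z) : IsGorensteinProjective Y := by
  refine isGorensteinProjective_of_class
    (𝒢 := fun Y => ∃ (X Z : C) (i : X ⟶ Y) (p : Y ⟶ Z) (z : i ≫ p = 0),
      IsGorensteinProjective X ∧ IsGorensteinProjective Z ∧ (ShortComplex.mk i p z).ShortExact)
    ?_ ?_ ?_ Y ⟨X, Z, i, p, z, hX, hZ, hS⟩
  · rintro Y ⟨X, Z, i, p, z, hX, hZ, hS⟩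
    obtain ⟨X', hX', P, a, b, hab, hP, hT⟩ := hX.exists_cosyzygy
    obtain ⟨Z', hZ', hZZ⟩ := hZ.exists_cosyzygy
    -- The pushout of `Y` along `a` is an extension of `Z` by the projective `P`. It splits, hence
    -- embeds in a projective `R` with cokernel `Z'`. As `Y` embeds in the pushout with cokernel
    -- `X'`, the cokernel of `Y` in `R` is an extension of `Z'` by `X'`.
    obtain ⟨q, hq, -, hE⟩ := shortExact_pushout hS a
    obtain ⟨e⟩ := nonempty_iso_biprod hE (hZ.extProjVanishes P hP)
    obtain ⟨R, c, d, hcd, hR, hU⟩ := (hZZ.biprod_right hP).of_iso e (Iso.refl _)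
    obtain ⟨q', hq', -, hE'⟩ := shortExact_pushout hT i
    let e' : pushout i a ≅ pushout a i := pushoutSymmetry i a
    obtain ⟨W, k, hk, hW, s, t, y, hst⟩ := shortExact_comp_of_mono hE'
      (j := e'.inv ≫ c) (ρ := d) (z' := by rw [Category.assoc, hcd, comp_zero])
      (ShortComplex.shortExact_of_iso (S₁ := ShortComplex.mk c d hcd)
        (ShortComplex.isoMk e' (Iso.refl _) (Iso.refl _)) hU)
    exact ⟨W, ⟨_, _, s, t, y, hX', hZ', hst⟩, R, _, _, _, hR, hW⟩
  · rintro Y ⟨X, Z, i, p, z, hX, hZ, hS⟩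
    obtain ⟨X', hX', hXX⟩ := hX.exists_syzygy
    obtain ⟨Z', hZ', P, a, b, hab, hP, hT⟩ := hZ.exists_syzygy
    -- Dually, the pullback of `Y` along `b` splits because `P` is projective. It maps onto `Y` with
    -- kernel `Z'` and is covered by `R` with kernel `X'`.
    obtain ⟨q, hq, -, hE⟩ := shortExact_pullback hS b
    obtain ⟨e⟩ := nonempty_iso_biprod hE (extVanishes_of_projective hP X)
    obtain ⟨R, c, d, hcd, hR, hU⟩ := (hXX.biprod_left hP).of_iso (Iso.refl _)
      (biprod.braiding _ _ ≪≫ e)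
    obtain ⟨q', hq', -, hE'⟩ := shortExact_pullback hT p
    let e' : pullback p b ≅ pullback b p := pullbackSymmetry p b
    obtain ⟨W, k, hk, hW, s, t, y, hst⟩ := shortExact_comp_of_epi
      (ShortComplex.shortExact_of_iso (S₁ := ShortComplex.mk c d hcd)
        (S₂ := ShortComplex.mk c (d ≫ e'.hom) (by rw [← Category.assoc, hcd, zero_comp]))
        (ShortComplex.isoMk (Iso.refl _) (Iso.refl _) e') hU) hE'
    exact ⟨W, ⟨_, _, s, t, y, hX', hZ', hst⟩, R, _, _, _, hR, hW⟩
  · rintro Y ⟨X, Z, i, p, z, hX, hZ, hS⟩ Q hQ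
    exact (hX.extProjVanishes Q hQ).of_shortExact hS (hZ.extProjVanishes Q hQ)

/-- If `x ⟶ E` is a monomorphism into a projective object through which some embedding of `x` in
a projective object with Gorenstein projective cokernel factors along a split epimorphism `q`, then
the cokernel of `x ⟶ E` is Gorenstein projective. -/
theorem isGorensteinProjective_cokernel {x E P y c : C} {f : x ⟶ E} {π : E ⟶ c} {z : f ≫ π = 0}
    (hS : (ShortComplex.mk f π z).ShortExact) (hE : Projective E) (q : E ⟶ P) (s : P ⟶ E)
    (hs : s ≫ q = 𝟙 P) {ρ : P ⟶ y} {z' : (f ≫ q) ≫ ρ = 0}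
    (hT : (ShortComplex.mk (f ≫ q) ρ z').ShortExact) (hy : IsGorensteinProjective y) :
    IsGorensteinProjective c := by
  have : Mono (f ≫ q) := hT.mono_f
  have : IsSplitEpi q := ⟨⟨s, hs⟩⟩
  -- The cokernel of `f` is an extension of `coker (f ≫ q)`, which is `y`, by `ker q`, a summand of
  -- `E`.
  obtain ⟨a, b, w, hU⟩ :=
    exists_shortExact_kernel_cokernel_cokernel f q
  have h1 : Projective (kernel q) := by
    refine Retract.projective (Y := E) ⟨kernel.ι q, kernel.lift q (𝟙 E - q ≫ s) (by simp [hs]), ?_⟩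
    rw [← cancel_mono (kernel.ι q)]
    simp
  refine (h1.isGorensteinProjective.of_shortExact hU (hy.of_iso
    ((cokernelIsCokernel (f ≫ q)).coconePointUniqueUpToIso hT.gIsCokernel).symm)).of_iso
    ((cokernelIsCokernel _).coconePointUniqueUpToIso hS.gIsCokernel)

/-- The dual of `isGorensteinProjective_cokernel`: the kernel of `f` is an extension of `coker q`, a
summand of `E`, by `ker (q ≫ f)`. -/
theorem isGorensteinProjective_kernel {x E P y c : C} {f : E ⟶ x} {π : c ⟶ E} {z : π ≫ f = 0}
    (hS : (ShortComplex.mk π f z).ShortExact) (hE : Projective E) (q : P ⟶ E) (s : E ⟶ P)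
    (hs : q ≫ s = 𝟙 P) {ρ : y ⟶ P} {z' : ρ ≫ q ≫ f = 0}
    (hT : (ShortComplex.mk ρ (q ≫ f) z').ShortExact) (hy : IsGorensteinProjective y) :
    IsGorensteinProjective c := by
  have : Epi (q ≫ f) := hT.epi_g
  have : IsSplitMono q := ⟨⟨s, hs⟩⟩
  obtain ⟨a, b, w, hU⟩ :=
    exists_shortExact_kernel_kernel_cokernel q f
  have h1 : Projective (cokernel q) := by
    refine Retract.projective (Y := E)
      ⟨cokernel.desc q (𝟙 E - s ≫ q) (by simp [reassoc_of% hs]), cokernel.π q, ?_⟩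
    rw [← cancel_epi (cokernel.π q)]
    simp
  refine (IsGorensteinProjective.of_shortExact hU (hy.of_iso
    ((kernelIsKernel (q ≫ f)).conePointUniqueUpToIso hT.fIsKernel).symm) h1.isGorensteinProjective).of_iso
    ((kernelIsKernel _).conePointUniqueUpToIso hS.fIsKernel)

end Abelian

/-! ### Transfer along functors with a right adjoint -/

section Transfer

variable {C : Type v} [Category.{w} C] [Abelian C]
variable {D : Type*} [Category* D] [Abelian D]

/-- The image of a totally acyclic complex is exact with projective terms, and by adjunction its
maps into `Q` are the maps of the original complex into the projective `R.obj Q`. -/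
theorem IsGorensteinProjective.map_of_adjunction (F : C ⥤ D) (R : D ⥤ C) (adj : F ⊣ R)
    [F.Additive] [PreservesFiniteLimits F] [PreservesFiniteColimits F]
    (hF : ∀ P, Projective P → Projective (F.obj P)) (hR : ∀ Q, Projective Q → Projective (R.obj Q))
    {X : C} (hX : IsGorensteinProjective X) : IsGorensteinProjective (F.obj X) := by
  obtain ⟨P, hP, i, z, ⟨hl⟩⟩ := hX
  refine ⟨(F.mapHomologicalComplex _).obj P, ⟨fun n => hF _ (hP.projective n), fun n => ?_,
    fun Q hQ n f hf => ?_⟩, F.map i, ?_, ⟨?_⟩⟩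
  · obtain ⟨m, rfl⟩ : ∃ m, n = m + 1 := ⟨n - 1, by ring⟩
    have h := hP.exactAt (m + 1)
    rw [HomologicalComplex.exactAt_iff' P m (m + 1) (m + 1 + 1) (by simp) (by simp)] at h
    rw [HomologicalComplex.exactAt_iff' _ m (m + 1) (m + 1 + 1) (by simp) (by simp)]
    exact h.map F
  · change F.obj (P.X n) ⟶ Q at f
    obtain ⟨g, hg⟩ := hP.hom_acyclic (R.obj Q) (hR Q hQ) n (adj.homEquiv _ _ f) (by
      have : F.map (P.d (n - 1) n) ≫ f = 0 := hf
      apply (adj.homEquiv _ _).symm.injective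
      rw [adj.homEquiv_naturality_left_symm, Equiv.symm_apply_apply, this]
      simp [Adjunction.homEquiv_counit])
    refine ⟨(adj.homEquiv _ _).symm g, ?_⟩
    change F.map (P.d n (n + 1)) ≫ _ = f
    rw [← adj.homEquiv_naturality_left_symm, hg, Equiv.symm_apply_apply]
  · change F.map i ≫ F.map (P.d 0 1) = 0
    rw [← F.map_comp, z, F.map_zero]
  · exact KernelFork.mapIsLimit _ hl F

end Transfer

/-! ### Exact structures on extension closed subcategories. -/

section ExactStructure

variable {C : Type v} [Category.{w} C] [Abelian C] {P : ObjectProperty C}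

theorem isInflation_iff {X Y : P.FullSubcategory} {i : X ⟶ Y} :
    IsInflation (conflations P) i ↔ ∃ (Z : C) (_ : P Z) (p : Y.obj ⟶ Z) (z : i.hom ≫ p = 0),
      (ShortComplex.mk i.hom p z).ShortExact := by
  constructor
  · rintro ⟨Z, p, z, h⟩
    exact ⟨Z.obj, Z.property, p.hom, _, h⟩
  · rintro ⟨Z, hZ, p, z, h⟩
    exact ⟨⟨Z, hZ⟩, ObjectProperty.homMk p, ObjectProperty.hom_ext _ z, h⟩

theorem isDeflation_iff {Y Z : P.FullSubcategory} {p : Y ⟶ Z} :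
    IsDeflation (conflations P) p ↔ ∃ (X : C) (_ : P X) (i : X ⟶ Y.obj) (z : i ≫ p.hom = 0),
      (ShortComplex.mk i p.hom z).ShortExact := by
  constructor
  · rintro ⟨X, i, z, h⟩
    exact ⟨X.obj, X.property, i.hom, _, h⟩
  · rintro ⟨X, hX, i, z, h⟩
    exact ⟨⟨X, hX⟩, ObjectProperty.homMk i, ObjectProperty.hom_ext _ z, h⟩

theorem shortExact_biprod (X Y : C) :
    (ShortComplex.mk (biprod.inl : X ⟶ X ⊞ Y) (biprod.snd : X ⊞ Y ⟶ Y) (by simp)).ShortExact :=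
  (ShortComplex.Splitting.ofHasBinaryBiproduct X Y).shortExact

/-- An extension closed full subcategory of an abelian category is an exact category. -/
theorem isExactStructure_conflations [P.IsClosedUnderIsomorphisms] [P.IsClosedUnderExtensions]
    (h0 : P 0) : IsExactStructure (conflations P) where
  hasZeroObject := ⟨⟨0, h0⟩,
    { unique_to := fun Y => ⟨⟨⟨0⟩, fun f =>
        ObjectProperty.hom_ext _ ((isZero_zero C).eq_of_src _ _)⟩⟩
      unique_from := fun Y => ⟨⟨⟨0⟩, fun f =>
        ObjectProperty.hom_ext _ ((isZero_zero C).eq_of_tgt _ _)⟩⟩ }⟩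
  hasBinaryBiproducts := ⟨fun X Y => hasBinaryBiproduct_of_total
    { pt := ⟨X.obj ⊞ Y.obj, P.prop_X₂_of_shortExact (shortExact_biprod X.obj Y.obj)
        X.property Y.property⟩
      fst := ObjectProperty.homMk biprod.fst
      snd := ObjectProperty.homMk biprod.snd
      inl := ObjectProperty.homMk biprod.inl
      inr := ObjectProperty.homMk biprod.inr
      inl_fst := ObjectProperty.hom_ext _ biprod.inl_fst
      inl_snd := ObjectProperty.hom_ext _ biprod.inl_snd
      inr_fst := ObjectProperty.hom_ext _ biprod.inr_fst
      inr_snd := ObjectProperty.hom_ext _ biprod.inr_snd }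
    (ObjectProperty.hom_ext _ biprod.total)⟩
  of_iso := by
    rintro S T ⟨e⟩ hS
    exact ShortComplex.shortExact_of_iso (P.ι.mapShortComplex.mapIso e) hS
  kernel S hS := by
    have hS' : (S.map P.ι).ShortExact := hS
    have := hS'.mono_f
    have : Mono S.f := P.ι.mono_of_mono_map this
    exact ⟨KernelFork.IsLimit.ofι' _ _ fun k hk =>
      ⟨ObjectProperty.homMk (hS'.exact.lift k.hom (congrArg InducedCategory.Hom.hom hk)),
        ObjectProperty.hom_ext _ (hS'.exact.lift_f _ _)⟩⟩
  cokernel S hS := by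
    have hS' : (S.map P.ι).ShortExact := hS
    have := hS'.epi_g
    have : Epi S.g := P.ι.epi_of_epi_map this
    exact ⟨CokernelCofork.IsColimit.ofπ' _ _ fun k hk =>
      ⟨ObjectProperty.homMk (hS'.exact.desc k.hom (congrArg InducedCategory.Hom.hom hk)),
        ObjectProperty.hom_ext _ (hS'.exact.g_desc _ _)⟩⟩
  inflation_id X := isInflation_iff.2 ⟨0, h0, 0, _, shortExact_id_zero X.obj⟩
  deflation_id X := isDeflation_iff.2 ⟨0, h0, 0, _, shortExact_zero_id X.obj⟩
  inflation_comp := by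
    intro X Y Z i j hi hj
    rw [isInflation_iff] at hi hj ⊢
    obtain ⟨A, hA, p, z, hS⟩ := hi
    obtain ⟨B, hB, q, y, hT⟩ := hj
    obtain ⟨W, r, x, hW, s, t, v, hst⟩ := shortExact_comp_of_mono hS hT
    exact ⟨W, P.prop_X₂_of_shortExact hst hA hB, r, x, hW⟩
  deflation_comp := by
    intro X Y Z p q hp hq
    rw [isDeflation_iff] at hp hq ⊢
    obtain ⟨A, hA, i, z, hS⟩ := hp
    obtain ⟨B, hB, j, y, hT⟩ := hq
    obtain ⟨W, r, x, hW, s, t, v, hst⟩ := shortExact_comp_of_epi hS hT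
    exact ⟨W, P.prop_X₂_of_shortExact hst hA hB, r, x, hW⟩
  pushout := by
    intro X Y X' i f hi
    obtain ⟨Z, hZ, p, z, hS⟩ := isInflation_iff.1 hi
    obtain ⟨p', z', -, hS'⟩ := shortExact_pushout hS f.hom
    refine ⟨⟨pushout i.hom f.hom, P.prop_X₂_of_shortExact hS' X'.property hZ⟩,
      ObjectProperty.homMk (pushout.inl _ _), ObjectProperty.homMk (pushout.inr _ _), ?_,
      isInflation_iff.2 ⟨Z, hZ, p', z', hS'⟩⟩
    exact IsPushout.of_map P.ι (ObjectProperty.hom_ext _ pushout.condition)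
      (IsPushout.of_hasPushout i.hom f.hom)
  pullback := by
    intro Y Z Z' p f hp
    obtain ⟨X, hX, i, z, hS⟩ := isDeflation_iff.1 hp
    obtain ⟨i', z', -, hS'⟩ := shortExact_pullback hS f.hom
    refine ⟨⟨pullback p.hom f.hom, P.prop_X₂_of_shortExact hS' hX Z'.property⟩,
      ObjectProperty.homMk (pullback.fst _ _), ObjectProperty.homMk (pullback.snd _ _), ?_,
      isDeflation_iff.2 ⟨X, hX, i', z', hS'⟩⟩
    exact IsPullback.of_map P.ι (ObjectProperty.hom_ext _ pullback.condition)
      (IsPullback.of_hasPullback p.hom f.hom)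

end ExactStructure

/-! ### The Frobenius category of Gorenstein projective objects -/

section Frobenius

variable {C : Type v} [Category.{w} C] [Abelian C]

instance : (IsGorensteinProjective (C := C)).IsClosedUnderExtensions where
  prop_X₂_of_shortExact hS h₁ h₃ := IsGorensteinProjective.of_shortExact hS h₁ h₃

theorem isExactProjective_of_projective {P : ObjectProperty C} {X : P.FullSubcategory}
    (hX : Projective X.obj) : IsExactProjective (conflations P) X := by
  intro Y Z p hp f
  obtain ⟨_, _, _, _, hS⟩ := isDeflation_iff.1 hp
  have : Epi p.hom := hS.epi_g
  exact ⟨ObjectProperty.homMk (Projective.factorThru f.hom p.hom),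
    ObjectProperty.hom_ext _ (Projective.factorThru_comp f.hom p.hom)⟩

/-- The cokernel of an inflation is Gorenstein projective, so Ext¹ from it into a projective
vanishes. -/
theorem isExactInjective_of_projective
    {X : (IsGorensteinProjective (C := C)).FullSubcategory} (hX : Projective X.obj) :
    IsExactInjective (conflations IsGorensteinProjective) X := by
  intro Y Z i hi f
  obtain ⟨A, hA, p, z, hS⟩ := isInflation_iff.1 hi
  obtain ⟨g, hg⟩ := IsGorensteinProjective.extProjVanishes hA _ hX _ _ _ hS f.hom
  exact ⟨ObjectProperty.homMk g, ObjectProperty.hom_ext _ hg⟩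

/-- The projective cover comes from the totally acyclic complex itself, so the ambient category need
not have enough projectives. -/
theorem exists_deflation (X : (IsGorensteinProjective (C := C)).FullSubcategory) :
    ∃ (Q : (IsGorensteinProjective (C := C)).FullSubcategory) (p : Q ⟶ X),
      Projective Q.obj ∧ IsDeflation (conflations IsGorensteinProjective) p := by
  obtain ⟨K, hK, Q, i, p, z, hQ, hS⟩ := IsGorensteinProjective.exists_syzygy X.property
  exact ⟨⟨Q, hQ.isGorensteinProjective⟩, ObjectProperty.homMk p, hQ,
    isDeflation_iff.2 ⟨K, hK, i, z, hS⟩⟩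

theorem exists_inflation (X : (IsGorensteinProjective (C := C)).FullSubcategory) :
    ∃ (Q : (IsGorensteinProjective (C := C)).FullSubcategory) (i : X ⟶ Q),
      Projective Q.obj ∧ IsInflation (conflations IsGorensteinProjective) i := by
  obtain ⟨K, hK, Q, i, p, z, hQ, hS⟩ := IsGorensteinProjective.exists_cosyzygy X.property
  exact ⟨⟨Q, hQ.isGorensteinProjective⟩, ObjectProperty.homMk i, hQ,
    isInflation_iff.2 ⟨K, hK, p, z, hS⟩⟩

theorem isExactProjective_iff {X : (IsGorensteinProjective (C := C)).FullSubcategory} :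
    IsExactProjective (conflations IsGorensteinProjective) X ↔ Projective X.obj := by
  refine ⟨fun h => ?_, isExactProjective_of_projective⟩
  obtain ⟨Q, p, hQ, hp⟩ := exists_deflation X
  obtain ⟨s, hs⟩ := h p hp (𝟙 X)
  exact Retract.projective (Y := Q.obj) ⟨s.hom, p.hom, congrArg InducedCategory.Hom.hom hs⟩

theorem isExactInjective_iff {X : (IsGorensteinProjective (C := C)).FullSubcategory} :
    IsExactInjective (conflations IsGorensteinProjective) X ↔ Projective X.obj := by
  refine ⟨fun h => ?_, isExactInjective_of_projective⟩
  obtain ⟨Q, i, hQ, hi⟩ := exists_inflation X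
  obtain ⟨r, hr⟩ := h i hi (𝟙 X)
  exact Retract.projective (Y := Q.obj) ⟨i.hom, r.hom, congrArg InducedCategory.Hom.hom hr⟩

/-- The Gorenstein projective objects of an abelian category form a Frobenius category. -/
theorem isFrobenius_isGorensteinProjective :
    IsFrobenius (conflations (IsGorensteinProjective (C := C))) where
  exact := isExactStructure_conflations
    (inferInstance : Projective (0 : C)).isGorensteinProjective
  enough_projectives X := by
    obtain ⟨Q, p, hQ, hp⟩ := exists_deflation X
    exact ⟨Q, p, isExactProjective_iff.2 hQ, hp⟩
  enough_injectives X := by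
    obtain ⟨Q, i, hQ, hi⟩ := exists_inflation X
    exact ⟨Q, i, isExactInjective_iff.2 hQ, hi⟩
  projective_iff_injective X := isExactProjective_iff.trans isExactInjective_iff.symm

end Frobenius

/-! ### Equivalences -/

section Equivalences

variable {C : Type v} [Category.{w} C] [Abelian C] {D : Type v} [Category.{w} D] [Abelian D]

theorem isGorensteinProjective_functor_obj (e : C ≌ D) [e.functor.Additive] {X : C}
    (hX : IsGorensteinProjective X) : IsGorensteinProjective (e.functor.obj X) :=
  hX.map_of_adjunction e.functor e.inverse e.toAdjunction
    (fun _ h => (e.map_projective_iff _).2 h) (fun _ h => (e.symm.map_projective_iff _).2 h)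

theorem isGorensteinProjective_functor_obj_iff (e : C ≌ D) [e.functor.Additive] {X : C} :
    IsGorensteinProjective (e.functor.obj X) ↔ IsGorensteinProjective X :=
  ⟨fun h => by
    have : e.symm.functor.Additive := inferInstanceAs e.inverse.Additive
    exact (isGorensteinProjective_functor_obj e.symm h).of_iso (e.unitIso.app X).symm,
    isGorensteinProjective_functor_obj e⟩

/-- An additive equivalence of abelian categories induces an exact equivalence between the full
subcategories of Gorenstein projective objects. -/
theorem exactEquivalent_isGorensteinProjective (e : C ≌ D) [e.functor.Additive] :
    ExactEquivalent (conflations (IsGorensteinProjective (C := C)))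
      (conflations (IsGorensteinProjective (C := D))) := by
  refine ⟨e.congrFullSubcategory (by
    ext X
    exact isGorensteinProjective_functor_obj_iff e), ⟨fun {X Y f g} => ?_⟩, fun S => ?_⟩
  · exact ObjectProperty.hom_ext _ (e.functor.map_add (f := f.hom) (g := g.hom))
  · exact (ShortExact.shortExact_map_iff e.functor (S := S.map (ObjectProperty.ι _))).symm

end Equivalences

/-! ### Winding of cyclic paths and the action of `Γ_n` along them. -/

section Transition

variable {A : Type u} [Ring A] {ω : A} {h : IsRegularNormal ω} {n : ℕ}

/-- The number of times the cyclic path from `i` to `j` passes through the twist. -/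
def wind (i j : Fin n) : ℕ := if i ≤ j then 0 else 1

/-- The twist along the cyclic path from `i` to `j`. -/
noncomputable def windHom (h : IsRegularNormal ω) (i j : Fin n) : A →+* A :=
  if i ≤ j then RingHom.id A else (h.sigma : A →+* A)

theorem windHom_mul (h : IsRegularNormal ω) (i j : Fin n) (a : A) :
    windHom h i j a * ω ^ wind i j = ω ^ wind i j * a := by
  unfold windHom wind
  split_ifs
  · simp
  · simpa using h.sigma_mul a

theorem IsRegularNormal.pow_right_cancel (h : IsRegularNormal ω) (k : ℕ) {a b : A}
    (e : a * ω ^ k = b * ω ^ k) : a = b := by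
  induction k with
  | zero => simpa using e
  | succ k ih =>
    rw [pow_succ, ← mul_assoc, ← mul_assoc] at e
    exact ih (h.right_cancel e)

/-- This makes `wind i j + wind j k - wind i k`, the number of superfluous full turns of a detour
through `j`, an honest subtraction in the natural numbers. -/
theorem wind_le (i j k : Fin n) : wind i k ≤ wind i j + wind j k := by
  unfold wind
  by_cases h1 : i ≤ j
  · by_cases h2 : j ≤ k
    · simp [h1, h2, h1.trans h2]
    · simp only [h1, h2, if_true, if_false]
      split_ifs <;> simp
  · simp only [h1, if_false]
    split_ifs <;> simp

/-! ### Coefficients of matrices in `Γ_n` -/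

/-- Indices are reversed because the unrestricted entries of `Γ_n` lie on and above the diagonal,
while structure maps raise the index. After reversal, entry `(i, j)` is the coefficient of the path
from `j` to `i`, and it is divisible by `ω` exactly as often as that path is required to wind. -/
theorem Gamma.exists_coef (m : Gamma h n) (i j : Fin n) :
    ∃ a : A, a * ω ^ wind j i = m.1 i.rev j.rev := by
  unfold wind
  split_ifs with hij
  · exact ⟨_, by rw [pow_zero, mul_one]⟩
  · obtain ⟨a, ha⟩ := m.2 i.rev j.rev (Fin.rev_lt_rev.2 (not_le.1 hij))
    exact ⟨a, by rw [ha, pow_one]⟩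

/-- The coefficient `a` with `m_{ij} = a` on or above the diagonal and `m_{ij} = a ω` below it,
with reversed indices. -/
noncomputable def Gamma.coef (m : Gamma h n) (i j : Fin n) : A := (Gamma.exists_coef m i j).choose

theorem Gamma.coef_mul (m : Gamma h n) (i j : Fin n) :
    Gamma.coef m i j * ω ^ wind j i = m.1 i.rev j.rev :=
  (Gamma.exists_coef m i j).choose_spec

theorem Gamma.coef_eq (m : Gamma h n) {i j : Fin n} {a : A}
    (e : m.1 i.rev j.rev = a * ω ^ wind j i) : Gamma.coef m i j = a :=
  h.pow_right_cancel (wind j i) (by rw [Gamma.coef_mul m, e])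

theorem Gamma.coef_one (i j : Fin n) : Gamma.coef (1 : Gamma h n) i j = if i = j then 1 else 0 := by
  apply Gamma.coef_eq
  change (1 : Matrix (Fin n) (Fin n) A) i.rev j.rev = _
  by_cases hij : i = j
  · subst hij
    simp [wind]
  · rw [Matrix.one_apply_ne (fun c => hij (Fin.rev_injective c)), if_neg hij, zero_mul]

theorem Gamma.coef_add (m m' : Gamma h n) (i j : Fin n) :
    Gamma.coef (m + m') i j = Gamma.coef m i j + Gamma.coef m' i j := by
  apply Gamma.coef_eq
  rw [add_mul, Gamma.coef_mul m, Gamma.coef_mul m']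
  rfl

theorem Gamma.coef_zero (i j : Fin n) : Gamma.coef (0 : Gamma h n) i j = 0 := by
  apply Gamma.coef_eq
  rw [zero_mul]
  rfl

/-- Moving the first power of `ω` past the second coefficient produces the twist `windHom`. What
remains after cancelling `ω ^ wind k i` is the excess winding, the same exponent as in
`ModFact.tr_tr`. -/
theorem Gamma.coef_mul_coef (m m' : Gamma h n) (i k : Fin n) :
    Gamma.coef (m * m') i k = ∑ j, Gamma.coef m i j * windHom h j i (Gamma.coef m' j k) *
      ω ^ (wind k j + wind j i - wind k i) := by
  apply Gamma.coef_eq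
  change (m.1 * m'.1) i.rev k.rev = _
  rw [Matrix.mul_apply, Finset.sum_mul, ← Equiv.sum_comp Fin.revPerm]
  refine Finset.sum_congr rfl fun j _ => ?_
  rw [Fin.revPerm_apply, ← Gamma.coef_mul m, ← Gamma.coef_mul m', mul_assoc, mul_assoc, mul_assoc, ← pow_add,
    Nat.sub_add_cancel (wind_le k j i), add_comm (wind k j), pow_add,
    ← mul_assoc (windHom h j i _), windHom_mul, mul_assoc]

/-! ### Matrix units of `Γ_n` -/

/-- The matrix with single nonzero entry `a` in position `(i, j)`, with reversed indices. -/
def Gamma.single (h : IsRegularNormal ω) (i j : Fin n) (a : A) (ha : i < j → ∃ b, a = b * ω) :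
    Gamma h n :=
  ⟨Matrix.single i.rev j.rev a, fun k l hkl => by
    by_cases hc : i.rev = k ∧ j.rev = l
    · obtain ⟨rfl, rfl⟩ := hc
      obtain ⟨b, hb⟩ := ha (Fin.rev_lt_rev.1 hkl)
      exact ⟨b, by rw [Matrix.single_apply_same, hb]⟩
    · exact ⟨0, by rw [Matrix.single_apply_of_ne _ _ _ _ _ hc, zero_mul]⟩⟩

theorem Gamma.single_congr {i j : Fin n} {a b : A} {ha : i < j → ∃ b, a = b * ω} (e : a = b) :
    Gamma.single h i j a ha = Gamma.single h i j b (e ▸ ha) := by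
  subst e
  rfl

theorem Gamma.single_mul {i j k : Fin n} {a b : A} {ha : i < j → ∃ b, a = b * ω}
    {hb : j < k → ∃ c, b = c * ω} (hab : i < k → ∃ c, a * b = c * ω) :
    Gamma.single h i j a ha * Gamma.single h j k b hb = Gamma.single h i k (a * b) hab :=
  Subtype.ext (Matrix.single_mul_single_same _ _ _ _ _)

theorem Gamma.single_mul_of_ne {i j j' k : Fin n} (hj : j ≠ j') {a b : A}
    {ha : i < j → ∃ b, a = b * ω} {hb : j' < k → ∃ c, b = c * ω} :
    Gamma.single h i j a ha * Gamma.single h j' k b hb = 0 :=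
  Subtype.ext (Matrix.single_mul_single_of_ne _ _ _ _ (fun c => hj (Fin.rev_injective c)) _)

/-- The scalar matrices in `Γ_n`. -/
def Gamma.scalar (h : IsRegularNormal ω) (n : ℕ) : A →+* Gamma h n :=
  (Matrix.scalar (Fin n)).codRestrict (Gamma h n) fun a i j hij =>
    ⟨0, by simp [Matrix.diagonal_apply_ne _ (ne_of_gt hij)]⟩

theorem Gamma.scalar_mul_single {i j : Fin n} {a b : A} {hb : i < j → ∃ c, b = c * ω}
    (hab : i < j → ∃ c, a * b = c * ω) :
    Gamma.scalar h n a * Gamma.single h i j b hb = Gamma.single h i j (a * b) hab := by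
  apply Subtype.ext
  change Matrix.diagonal (fun _ => a) * Matrix.single i.rev j.rev b = Matrix.single _ _ _
  ext k l
  rw [Matrix.diagonal_mul, Matrix.single_apply, Matrix.single_apply]
  split_ifs <;> simp

theorem Gamma.single_mul_scalar {i j : Fin n} {a b : A} {hb : i < j → ∃ c, b = c * ω}
    (hab : i < j → ∃ c, b * a = c * ω) :
    Gamma.single h i j b hb * Gamma.scalar h n a = Gamma.single h i j (b * a) hab := by
  apply Subtype.ext
  change Matrix.single i.rev j.rev b * Matrix.diagonal (fun _ => a) = Matrix.single _ _ _
  ext k l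
  rw [Matrix.mul_diagonal, Matrix.single_apply, Matrix.single_apply]
  split_ifs <;> simp

theorem Gamma.mul_pow_wind {i j : Fin n} (a : A) (hij : i < j) :
    ∃ b, a * ω ^ wind j i = b * ω :=
  ⟨a, by simp [wind, not_le.2 hij]⟩

theorem Gamma.coef_single (i j k l : Fin n) (a : A) :
    Gamma.coef (Gamma.single h i j (a * ω ^ wind j i) (Gamma.mul_pow_wind a)) k l =
      if k = i ∧ l = j then a else 0 := by
  apply Gamma.coef_eq
  change Matrix.single _ _ _ _ _ = _
  by_cases hc : k = i ∧ l = j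
  · obtain ⟨rfl, rfl⟩ := hc
    simp
  · rw [if_neg hc, zero_mul, Matrix.single_apply_of_ne]
    rintro ⟨h1, h2⟩
    exact hc ⟨(Fin.rev_injective h1).symm, (Fin.rev_injective h2).symm⟩

/-! ### Transition maps of module factorizations -/

variable [NeZero n]

namespace ModFact

/-- The structure map `Xⁱ → Xʲ` for `i ≤ j`. -/
def lin (X : ModFact h n) {i j : Fin n} (hij : i ≤ j) : X.component i →ₗ[A] X.component j :=
  (X.seq.map (homOfLE hij)).hom

theorem lin_self (X : ModFact h n) {i : Fin n} (x : X.component i) : X.lin (le_refl i) x = x := by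
  change (X.seq.map (𝟙 i)).hom x = x
  rw [X.seq.map_id]
  rfl

theorem lin_lin (X : ModFact h n) {i j k : Fin n} (hij : i ≤ j) (hjk : j ≤ k)
    (x : X.component i) : X.lin hjk (X.lin hij x) = X.lin (hij.trans hjk) x := by
  change (X.seq.map (homOfLE hij) ≫ X.seq.map (homOfLE hjk)).hom x = _
  rw [← X.seq.map_comp]
  rfl

/-- The last structure map as an additive map. -/
noncomputable def lst (X : ModFact h n) : X.component (lastIdx n) →+ X.component 0 where
  toFun x := (X.last.hom x : X.component 0)
  map_zero' := X.last.hom.map_zero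
  map_add' := X.last.hom.map_add

theorem lst_smul (X : ModFact h n) (a : A) (x : X.component (lastIdx n)) :
    X.lst (a • x) = h.sigma a • X.lst x :=
  X.last.hom.map_smul a x

theorem lin_lst_lin_self (X : ModFact h n) (i : Fin n) (x : X.component i) :
    X.lin (zero_le_idx i) (X.lst (X.lin (le_lastIdx i) x)) = ω • x :=
  congrArg (fun f => f.hom x) (X.comp_eq i)

theorem lin_lst_lin (X : ModFact h n) {i k : Fin n} (hik : i ≤ k) (x : X.component i) :
    X.lin (zero_le_idx k) (X.lst (X.lin (le_lastIdx i) x)) = ω • X.lin hik x := by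
  rw [← map_smul, ← X.lin_lst_lin_self, lin_lin]

/-- The transition map from `Xⁱ` to `Xʲ` along the cyclic path. -/
noncomputable def tr (X : ModFact h n) (i j : Fin n) : X.component i →+ X.component j :=
  if hij : i ≤ j then (X.lin hij).toAddMonoidHom
  else (X.lin (zero_le_idx j)).toAddMonoidHom.comp
    (X.lst.comp (X.lin (le_lastIdx i)).toAddMonoidHom)

theorem tr_of_le (X : ModFact h n) {i j : Fin n} (hij : i ≤ j) (x : X.component i) :
    X.tr i j x = X.lin hij x := by
  rw [tr, dif_pos hij]
  rfl

theorem tr_of_not_le (X : ModFact h n) {i j : Fin n} (hij : ¬ i ≤ j) (x : X.component i) :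
    X.tr i j x = X.lin (zero_le_idx j) (X.lst (X.lin (le_lastIdx i) x)) := by
  rw [tr, dif_neg hij]
  rfl

theorem tr_self (X : ModFact h n) {i : Fin n} (x : X.component i) : X.tr i i x = x := by
  rw [tr_of_le X le_rfl, lin_self]

theorem tr_smul (X : ModFact h n) (i j : Fin n) (a : A) (x : X.component i) :
    X.tr i j (a • x) = windHom h i j a • X.tr i j x := by
  by_cases hij : i ≤ j
  · rw [tr_of_le X hij, tr_of_le X hij, windHom, if_pos hij, map_smul, RingHom.id_apply]
  · rw [tr_of_not_le X hij, tr_of_not_le X hij, windHom, if_neg hij, map_smul, lst_smul, map_smul]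
    rfl

/-- A detour differs from the direct path by at most one full turn, and a full turn is
multiplication by `ω`. -/
theorem tr_tr (X : ModFact h n) (i j k : Fin n) (x : X.component i) :
    X.tr j k (X.tr i j x) = ω ^ (wind i j + wind j k - wind i k) • X.tr i k x := by
  by_cases h1 : i ≤ j <;> by_cases h2 : j ≤ k
  · have h3 := h1.trans h2
    rw [tr_of_le X h1, tr_of_le X h2, tr_of_le X h3, lin_lin]
    simp [wind, h1, h2, h3]
  · by_cases h3 : i ≤ k
    · rw [tr_of_le X h1, tr_of_not_le X h2, tr_of_le X h3, lin_lin, lin_lst_lin X h3]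
      simp [wind, h1, h2, h3]
    · rw [tr_of_le X h1, tr_of_not_le X h2, tr_of_not_le X h3, lin_lin]
      simp [wind, h1, h2, h3]
  · by_cases h3 : i ≤ k
    · rw [tr_of_not_le X h1, tr_of_le X h2, tr_of_le X h3, lin_lin, lin_lst_lin X h3]
      simp [wind, h1, h2, h3]
    · rw [tr_of_not_le X h1, tr_of_le X h2, tr_of_not_le X h3, lin_lin]
      simp [wind, h1, h2, h3]
  · have h3 : ¬ i ≤ k := fun c => h1 (c.trans (le_of_lt (not_le.1 h2)))
    rw [tr_of_not_le X h1, tr_of_not_le X h2, tr_of_not_le X h3, lin_lin,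
      lin_lst_lin X (zero_le_idx k)]
    simp [wind, h1, h2, h3]

/-- The transition maps determine the last structure map. For `n = 1` the positions `lastIdx n` and
0 coincide, so `tr` is the identity there and the full turn `ω` must be supplied separately. -/
theorem lst_eq (X : ModFact h n) (x : X.component (lastIdx n)) :
    X.lst x = (if lastIdx n ≤ 0 then ω else 1) • X.tr (lastIdx n) 0 x := by
  split_ifs with h0
  · rw [tr_of_le X h0, ← lin_lst_lin, lin_self, lin_self]
  · rw [tr_of_not_le X h0, lin_self, lin_self, one_smul]

/-- The linear maps underlying a morphism. -/
def Hom.lin {X Y : ModFact h n} (f : X ⟶ Y) (i : Fin n) : X.component i →ₗ[A] Y.component i :=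
  ((Hom.app f).app i).hom

theorem Hom.lin_tr {X Y : ModFact h n} (f : X ⟶ Y) (i j : Fin n) (x : X.component i) :
    Hom.lin f j (X.tr i j x) = Y.tr i j (Hom.lin f i x) := by
  have key : ∀ {i j : Fin n} (hij : i ≤ j) (x : X.component i),
      Hom.lin f j (X.lin hij x) = Y.lin hij (Hom.lin f i x) := fun hij x =>
    congrArg (fun g => g.hom x) ((Hom.app f).naturality (homOfLE hij))
  have key' : ∀ x, Hom.lin f 0 (X.lst x) = Y.lst (Hom.lin f (lastIdx n) x) := fun x =>
    congrArg (fun g => g.hom x) (Hom.comm f)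
  by_cases hij : i ≤ j
  · rw [tr_of_le X hij, tr_of_le Y hij, key]
  · rw [tr_of_not_le X hij, tr_of_not_le Y hij, key, key', key]

/-- A family of linear maps commuting with all transition maps is a morphism. -/
def homMk {X Y : ModFact h n} (f : ∀ i, X.component i →ₗ[A] Y.component i)
    (hf : ∀ i j x, f j (X.tr i j x) = Y.tr i j (f i x)) : X ⟶ Y where
  app :=
    { app := fun i => ModuleCat.ofHom (f i)
      naturality := fun i j g => ModuleCat.hom_ext (LinearMap.ext fun x => by
        have := hf i j x
        rw [tr_of_le X (leOfHom g), tr_of_le Y (leOfHom g)] at this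
        exact this) }
  comm := ModuleCat.hom_ext (LinearMap.ext fun x => by
    change f 0 (X.lst x) = Y.lst (f (lastIdx n) x)
    rw [lst_eq, lst_eq, map_smul, hf])

theorem lin_homMk {X Y : ModFact h n} (f : ∀ i, X.component i →ₗ[A] Y.component i)
    (hf : ∀ i j x, f j (X.tr i j x) = Y.tr i j (f i x)) (i : Fin n) :
    Hom.lin (homMk f hf) i = f i := rfl

theorem hom_ext_lin {X Y : ModFact h n} {f g : X ⟶ Y} (e : ∀ i x, Hom.lin f i x = Hom.lin g i x) :
    f = g :=
  hom_ext (NatTrans.ext (funext fun i => ModuleCat.hom_ext (LinearMap.ext (e i))))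

end ModFact

/-! ### From module factorizations to `Γ_n`-modules -/

namespace ModFact

/-- The `Γ_n`-module structure on the product of the components of a module factorization. -/
@[reducible]
noncomputable def gammaModule (X : ModFact h n) : Module (Gamma h n) (∀ i, X.component i) where
  smul m x := fun i => ∑ j, Gamma.coef m i j • X.tr j i (x j)
  one_smul x := funext fun i => by
    change ∑ j, Gamma.coef (1 : Gamma h n) i j • X.tr j i (x j) = x i
    rw [Finset.sum_eq_single i]
    · rw [Gamma.coef_one, if_pos rfl, one_smul, tr_self]
    · intro j _ hj
      rw [Gamma.coef_one, if_neg (Ne.symm hj), zero_smul]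
    · simp
  mul_smul m m' x := funext fun i => by
    change ∑ k, Gamma.coef (m * m') i k • X.tr k i (x k) =
      ∑ j, Gamma.coef m i j • X.tr j i (∑ k, Gamma.coef m' j k • X.tr k j (x k))
    simp only [Gamma.coef_mul_coef, Finset.sum_smul, map_sum, Finset.smul_sum]
    rw [Finset.sum_comm]
    refine Finset.sum_congr rfl fun j _ => Finset.sum_congr rfl fun k _ => ?_
    rw [tr_smul, tr_tr, mul_smul, mul_smul]
  smul_zero m := funext fun i => by
    change ∑ j, Gamma.coef m i j • X.tr j i 0 = 0
    simp
  smul_add m x y := funext fun i => by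
    change ∑ j, Gamma.coef m i j • X.tr j i (x j + y j) =
      ∑ j, Gamma.coef m i j • X.tr j i (x j) + ∑ j, Gamma.coef m i j • X.tr j i (y j)
    simp [Finset.sum_add_distrib]
  add_smul m m' x := funext fun i => by
    change ∑ j, Gamma.coef (m + m') i j • X.tr j i (x j) =
      ∑ j, Gamma.coef m i j • X.tr j i (x j) + ∑ j, Gamma.coef m' i j • X.tr j i (x j)
    simp [Gamma.coef_add, add_smul, Finset.sum_add_distrib]
  zero_smul x := funext fun i => by
    change ∑ j, Gamma.coef (0 : Gamma h n) i j • X.tr j i (x j) = 0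
    simp [Gamma.coef_zero]

end ModFact

variable (h n) in
/-- The functor sending a module factorization to the product of its components. -/
noncomputable def toGamma : ModFact h n ⥤ ModuleCat.{u} (Gamma h n) where
  obj X := @ModuleCat.of (Gamma h n) _ (∀ i, X.component i) _ X.gammaModule
  map {X Y} f := by
    letI := X.gammaModule
    letI := Y.gammaModule
    exact ModuleCat.ofHom
      { toFun := fun x i => ModFact.Hom.lin f i (x i)
        map_add' := fun x y => funext fun i => map_add _ _ _
        map_smul' := fun m x => funext fun i => by
          change ModFact.Hom.lin f i (∑ j, Gamma.coef m i j • X.tr j i (x j)) =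
            ∑ j, Gamma.coef m i j • Y.tr j i (ModFact.Hom.lin f j (x j))
          simp only [map_sum, map_smul, ModFact.Hom.lin_tr] }
  map_id X := rfl
  map_comp f g := rfl

instance : (toGamma h n).Additive where
  map_add := rfl

end Transition

/-! ### Idempotents of `Γ_n` and the equivalence with `Γ_n`-modules. -/

section Equivalence

variable {A : Type u} [Ring A] {ω : A} {h : IsRegularNormal ω} {n : ℕ}

/-- The diagonal matrix units. -/
def Gamma.idem (h : IsRegularNormal ω) (i : Fin n) : Gamma h n :=
  Gamma.single h i i 1 fun c => absurd c (lt_irrefl i)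

theorem Gamma.single_eq_idem_mul {i j : Fin n} {a : A} {ha : i < j → ∃ b, a = b * ω} :
    Gamma.idem h i * Gamma.single h i j a ha = Gamma.single h i j a ha := by
  unfold Gamma.idem
  rw [Gamma.single_mul (by rwa [one_mul])]
  exact Gamma.single_congr (one_mul a)

theorem Gamma.scalar_mul_idem (a : A) (i : Fin n) :
    Gamma.scalar h n a * Gamma.idem h i =
      Gamma.single h i i a fun c => absurd c (lt_irrefl i) := by
  unfold Gamma.idem
  rw [Gamma.scalar_mul_single fun c => absurd c (lt_irrefl i)]
  exact Gamma.single_congr (mul_one a)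

theorem Gamma.sum_idem : ∑ i, Gamma.idem h i = (1 : Gamma h n) := by
  apply Subtype.ext
  rw [AddSubmonoidClass.coe_finsetSum]
  change ∑ i : Fin n, Matrix.single i.rev i.rev (1 : A) = 1
  rw [← Matrix.sum_single_one, ← Equiv.sum_comp Fin.revPerm]
  simp

theorem Gamma.eq_sum_mul_idem (m : Gamma h n) (j : Fin n) :
    m * Gamma.idem h j = ∑ i, Gamma.single h i j (Gamma.coef m i j * ω ^ wind j i)
      (Gamma.mul_pow_wind _) := by
  apply Subtype.ext
  rw [AddSubmonoidClass.coe_finsetSum]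
  change m.1 * Matrix.single j.rev j.rev 1 =
    ∑ i : Fin n, Matrix.single i.rev j.rev (Gamma.coef m i j * ω ^ wind j i)
  simp only [Gamma.coef_mul]
  ext k l
  rw [Matrix.sum_apply, Finset.sum_eq_single k.rev]
  · by_cases hl : l = j.rev
    · subst hl
      simp
    · rw [Matrix.mul_single_apply_of_ne _ _ _ _ _ hl, Matrix.single_apply_of_ne]
      exact fun c => hl c.2.symm
  · intro b _ hb
    rw [Matrix.single_apply_of_ne]
    rintro ⟨rfl, -⟩
    simp at hb
  · simp

/-! ### From `Γ_n`-modules to module factorizations -/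

section Peirce

variable {M : Type u} [AddCommGroup M] [Module (Gamma h n) M]

variable (h M) in
/-- The `i`-th Peirce component `e_i M` of a `Γ_n`-module `M`. -/
def peirce (i : Fin n) : AddSubgroup M where
  carrier := {x | Gamma.idem h i • x = x}
  zero_mem' := smul_zero _
  add_mem' {x y} hx hy := by
    change _ • (x + y) = x + y
    rw [smul_add, hx, hy]
  neg_mem' {x} hx := by
    change _ • (-x) = -x
    rw [smul_neg, hx]

theorem single_smul_mem_peirce {i j : Fin n} {a : A} (ha : i < j → ∃ b, a = b * ω) (x : M) :
    Gamma.single h i j a ha • x ∈ peirce h M i := by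
  change Gamma.idem h i • Gamma.single h i j a ha • x = _
  rw [← mul_smul, Gamma.single_eq_idem_mul]

theorem scalar_smul_eq {i : Fin n} (a : A) {x : M} (hx : x ∈ peirce h M i) :
    Gamma.scalar h n a • x = Gamma.single h i i a (fun c => absurd c (lt_irrefl i)) • x := by
  conv_lhs => rw [← show _ • x = x from hx]
  rw [← mul_smul, Gamma.scalar_mul_idem]

noncomputable instance peirceModule (i : Fin n) : Module A (peirce h M i) where
  smul a x := ⟨Gamma.scalar h n a • x.1, by
    rw [scalar_smul_eq a x.2]
    exact single_smul_mem_peirce _ _⟩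
  one_smul x := Subtype.ext (by
    change Gamma.scalar h n 1 • x.1 = x.1
    rw [map_one, one_smul])
  mul_smul a b x := Subtype.ext (by
    change Gamma.scalar h n (a * b) • x.1 = Gamma.scalar h n a • Gamma.scalar h n b • x.1
    rw [map_mul, mul_smul])
  smul_zero a := Subtype.ext (smul_zero (Gamma.scalar h n a))
  smul_add a x y := Subtype.ext (smul_add (Gamma.scalar h n a) x.1 y.1)
  add_smul a b x := Subtype.ext (by
    change Gamma.scalar h n (a + b) • x.1 = Gamma.scalar h n a • x.1 + Gamma.scalar h n b • x.1
    rw [map_add, add_smul])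
  zero_smul x := Subtype.ext (by
    change Gamma.scalar h n 0 • x.1 = 0
    rw [map_zero, zero_smul])

/-- Multiplication with a matrix unit on or above the diagonal. -/
noncomputable def peirceMap {i j : Fin n} (hij : i ≤ j) : peirce h M i →ₗ[A] peirce h M j where
  toFun x := ⟨Gamma.single h j i 1 (fun c => absurd c (not_lt.2 hij)) • x.1,
    single_smul_mem_peirce _ _⟩
  map_add' x y := Subtype.ext (smul_add _ x.1 y.1)
  map_smul' a x := Subtype.ext (by
    change Gamma.single h j i 1 _ • Gamma.scalar h n a • x.1 =
      Gamma.scalar h n a • Gamma.single h j i 1 _ • x.1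
    rw [← mul_smul, ← mul_smul, Gamma.single_mul_scalar fun c => absurd c (not_lt.2 hij),
      Gamma.scalar_mul_single fun c => absurd c (not_lt.2 hij)]
    simp only [one_mul, mul_one])

theorem coe_sum_smul {ι : Type*} (s : Finset ι) {i : Fin n} (a : ι → A) (x : ι → peirce h M i) :
    ((∑ k ∈ s, a k • x k : peirce h M i) : M) = ∑ k ∈ s, Gamma.scalar h n (a k) • (x k : M) := by
  rw [AddSubgroup.val_finsetSum]
  rfl

theorem idem_smul_of_ne {i j : Fin n} (hij : j ≠ i) {x : M} (hx : x ∈ peirce h M i) :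
    Gamma.idem h j • x = 0 := by
  rw [← show _ • x = x from hx, ← mul_smul]
  unfold Gamma.idem
  rw [Gamma.single_mul_of_ne hij, zero_smul]

end Peirce

variable [NeZero n]

namespace ModFact

theorem single_smul (X : ModFact h n) (i j : Fin n) (a : A) (x : ∀ i, X.component i) :
    X.gammaModule.smul (Gamma.single h i j (a * ω ^ wind j i) (Gamma.mul_pow_wind a)) x =
      Pi.single i (a • X.tr j i (x j)) := by
  funext k
  change ∑ l, _ • X.tr l k (x l) = _
  simp only [Gamma.coef_single]
  by_cases hk : k = i
  · subst hk
    rw [Pi.single_eq_same, Finset.sum_eq_single j]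
    · simp
    · intro l _ hl
      simp [hl]
    · simp
  · rw [Pi.single_eq_of_ne hk]
    exact Finset.sum_eq_zero fun l _ => by simp [hk]

end ModFact

instance : (toGamma h n).Faithful where
  map_injective {X Y f g} e := ModFact.hom_ext_lin fun i x => by
    have := congrArg (fun φ => φ.hom (Pi.single i x : ∀ i, X.component i) i) e
    change ModFact.Hom.lin f i ((Pi.single i x : ∀ i, X.component i) i) =
      ModFact.Hom.lin g i ((Pi.single i x : ∀ i, X.component i) i) at this
    rwa [Pi.single_eq_same] at this

/-- Linearity over the diagonal idempotents forces `G` to be diagonal, multiples of these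
idempotents make its blocks `A`-linear, and the off-diagonal units make the blocks commute with the
transition maps. -/
instance : (toGamma h n).Full where
  map_surjective {X Y} g := by
    let G : (∀ i, X.component i) →+ (∀ i, Y.component i) := g.hom.toAddMonoidHom
    have hG : ∀ i j (a : A) (x : ∀ i, X.component i),
        G (Pi.single i (a • X.tr j i (x j))) = Pi.single i (a • Y.tr j i (G x j)) := by
      intro i j a x
      rw [← X.single_smul, ← Y.single_smul]
      exact g.hom.map_smul _ _
    have hG' : ∀ i j (a : A) (x : X.component j),
        G (Pi.single i (a • X.tr j i x)) i = a • Y.tr j i (G (Pi.single j x) j) := by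
      intro i j a x
      have := congrFun (hG i j a (Pi.single j x)) i
      rwa [Pi.single_eq_same, Pi.single_eq_same] at this
    refine ⟨ModFact.homMk (fun i =>
      { toFun := fun x => G (Pi.single i x) i
        map_add' := fun x y => by rw [Pi.single_add, map_add]; rfl
        map_smul' := fun a x => by
          have := hG' i i a x
          rwa [ModFact.tr_self, ModFact.tr_self] at this }) fun i j x => ?_, ?_⟩
    · have := hG' j i 1 x
      rwa [one_smul, one_smul] at this
    · refine ModuleCat.hom_ext (LinearMap.ext fun (x : ∀ i, X.component i) => funext fun i => ?_)
      change G (Pi.single i (x i)) i = G x i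
      have := congrFun (hG i i 1 x) i
      rwa [one_smul, one_smul, ModFact.tr_self, ModFact.tr_self, Pi.single_eq_same] at this

section Peirce

variable {M : Type u} [AddCommGroup M] [Module (Gamma h n) M]

variable (h n) in
/-- The matrix unit multiplied by `ω` in the lower left corner of `Γ_n`. -/
def Gamma.corner : Gamma h n := Gamma.single h 0 (lastIdx n) ω fun _ => ⟨1, (one_mul ω).symm⟩

/-- Multiplication with the corner element of `Γ_n`. -/
noncomputable def peirceLast : ModuleCat.of A (peirce h M (lastIdx n)) ⟶
    h.twist.obj (ModuleCat.of A (peirce h M (0 : Fin n))) :=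
  ModuleCat.ofHom (Y := h.twist.obj (ModuleCat.of A (peirce h M (0 : Fin n))))
    { toFun := fun x => (⟨Gamma.corner h n • x.1, single_smul_mem_peirce _ _⟩ : peirce h M 0)
      map_add' := fun x y => Subtype.ext (smul_add (Gamma.corner h n) x.1 y.1)
      map_smul' := fun a x => Subtype.ext (by
        change Gamma.corner h n • Gamma.scalar h n a • x.1 =
          Gamma.scalar h n (h.sigma a) • Gamma.corner h n • x.1
        unfold Gamma.corner
        rw [← mul_smul, ← mul_smul,
          Gamma.single_mul_scalar fun _ => ⟨h.sigma a, (h.sigma_mul a).symm⟩,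
          Gamma.scalar_mul_single fun _ => ⟨h.sigma a, rfl⟩]
        simp only [h.sigma_mul]) }

/-- The path from `j` through the twist to `i` picks up one `ω`. The case `i = j` is the
factorization condition for the Peirce components. -/
theorem corner_loop (i j : Fin n) :
    Gamma.single h i 0 1 (fun c => absurd c (not_lt.2 (zero_le_idx i))) *
      (Gamma.corner h n *
        Gamma.single h (lastIdx n) j 1 (fun c => absurd c (not_lt.2 (le_lastIdx j)))) =
    Gamma.single h i j ω fun _ => ⟨1, (one_mul ω).symm⟩ := by
  unfold Gamma.corner
  rw [Gamma.single_mul fun _ => ⟨1, by rw [mul_one, one_mul]⟩,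
    Gamma.single_mul fun _ => ⟨1, by rw [mul_one]⟩]
  exact Gamma.single_congr (by rw [mul_one, one_mul])

variable (M) in
/-- The module factorization of Peirce components of a `Γ_n`-module. -/
noncomputable def ofGamma : ModFact h n where
  seq :=
    { obj := fun i => ModuleCat.of A (peirce h M i)
      map := fun f => ModuleCat.ofHom (peirceMap (leOfHom f))
      map_id := fun i => ModuleCat.hom_ext (LinearMap.ext fun x => Subtype.ext x.2)
      map_comp := fun {i j k} f g => ModuleCat.hom_ext (LinearMap.ext fun x => Subtype.ext (by
        change Gamma.single h k i 1 _ • x.1 = Gamma.single h k j 1 _ • Gamma.single h j i 1 _ • x.1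
        rw [← mul_smul, Gamma.single_mul
          (fun c => absurd c (not_lt.2 (leOfHom (f ≫ g))))]
        simp only [mul_one])) }
  last := peirceLast
  comp_eq := fun i => ModuleCat.hom_ext (LinearMap.ext fun x => Subtype.ext (by
    change Gamma.single h i 0 1 _ • Gamma.corner h n • Gamma.single h (lastIdx n) i 1 _ • x.1 =
      Gamma.scalar h n ω • x.1
    rw [scalar_smul_eq ω x.2, ← mul_smul, ← mul_smul, mul_assoc, corner_loop]))

theorem coe_ofGamma_tr (i j : Fin n) (x : peirce h M i) :
    Subtype.val (p := (· ∈ peirce h M j)) ((ofGamma M).tr i j x) =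
      Gamma.single h j i (1 * ω ^ wind i j) (Gamma.mul_pow_wind 1) • (x : M) := by
  by_cases hij : i ≤ j
  · refine (congrArg Subtype.val (ModFact.tr_of_le (ofGamma M) hij x)).trans ?_
    change Gamma.single h j i 1 _ • x.1 = _
    congr 1
    exact Gamma.single_congr (by simp [wind, hij])
  · refine (congrArg Subtype.val (ModFact.tr_of_not_le (ofGamma M) hij x)).trans ?_
    change Gamma.single h j 0 1 _ • Gamma.corner h n • Gamma.single h (lastIdx n) i 1 _ • x.1 = _
    rw [← mul_smul, ← mul_smul, mul_assoc, corner_loop]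
    congr 1
    exact Gamma.single_congr (by simp [wind, hij])

variable (M) in
/-- The Peirce decomposition of a `Γ_n`-module. -/
noncomputable def peirceEquiv : letI := (ofGamma (h := h) (n := n) M).gammaModule
    (∀ i, (ofGamma (h := h) (n := n) M).component i) ≃ₗ[Gamma h n] M :=
  letI := (ofGamma (h := h) (n := n) M).gammaModule
  { toFun := fun (x : ∀ i, peirce h M i) => ∑ i, (x i : M)
    map_add' := fun (x y : ∀ i, peirce h M i) => by
      change ∑ i, ((x i + y i : peirce h M i) : M) = _
      simp [Finset.sum_add_distrib]
    map_smul' := fun m (x : ∀ i, peirce h M i) => by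
      change ∑ i, ((∑ j, Gamma.coef m i j •
        ((ofGamma M).tr j i (x j) : peirce h M i) : peirce h M i) : M) = m • ∑ i, (x i : M)
      have key : ∀ i, ((∑ j, Gamma.coef m i j •
          ((ofGamma M).tr j i (x j) : peirce h M i) : peirce h M i) : M) =
          ∑ j, Gamma.scalar h n (Gamma.coef m i j) •
            Gamma.single h i j (1 * ω ^ wind j i) (Gamma.mul_pow_wind 1) • (x j : M) := fun i =>
        (coe_sum_smul _ _ _).trans (Finset.sum_congr rfl fun j _ =>
          congrArg (Gamma.scalar h n (Gamma.coef m i j) • ·) (coe_ofGamma_tr j i (x j)))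
      rw [Finset.sum_congr rfl fun i _ => key i, Finset.sum_comm, Finset.smul_sum]
      refine Finset.sum_congr rfl fun j _ => ?_
      -- Since `x j` is fixed by the `j`-th idempotent, only column `j` of `m` acts on it, and that
      -- column is a sum of matrix units.
      conv_rhs => rw [← show _ • (x j : M) = x j from (x j).2]
      rw [← mul_smul, Gamma.eq_sum_mul_idem, Finset.sum_smul]
      refine Finset.sum_congr rfl fun i _ => ?_
      rw [← mul_smul, Gamma.scalar_mul_single (by rw [one_mul]; exact Gamma.mul_pow_wind _)]
      congr 1
      exact Gamma.single_congr (by rw [one_mul])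
    invFun := fun x i => (⟨Gamma.idem h i • x, single_smul_mem_peirce _ _⟩ : peirce h M i)
    left_inv := fun (x : ∀ i, peirce h M i) => funext fun i => Subtype.ext (by
      change Gamma.idem h i • ∑ i, (x i : M) = x i
      rw [Finset.smul_sum, Finset.sum_eq_single i]
      · exact (x i).2
      · intro j _ hj
        exact idem_smul_of_ne (Ne.symm hj) (x j).2
      · simp)
    right_inv := fun x => by
      change ∑ i, Gamma.idem h i • x = x
      rw [← Finset.sum_smul, Gamma.sum_idem, one_smul] }

end Peirce

instance : (toGamma h n).EssSurj where
  mem_essImage M := ⟨ofGamma M, ⟨by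
    letI := (ofGamma (h := h) (n := n) M).gammaModule
    exact (peirceEquiv M).toModuleIso⟩⟩

instance : (toGamma h n).IsEquivalence where

instance : HasFiniteProducts (ModFact h n) := ⟨fun _ =>
  Adjunction.hasLimitsOfShape_of_equivalence (toGamma h n)⟩

/-- Kernels and cokernels are transported from `Γ_n`-modules. Their components are later controlled
through exactness of `ev`. -/
noncomputable instance : Abelian (ModFact h n) := abelianOfEquivalence (toGamma h n)

theorem exactEquivalent_gamma : ExactEquivalent
    (conflations (IsGorensteinProjective (C := ModFact h n)))
    (conflations (IsGorensteinProjective (C := ModuleCat.{u} (Gamma h n)))) := by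
  have : (toGamma h n).asEquivalence.functor.Additive :=
    inferInstanceAs (toGamma h n).Additive
  exact exactEquivalent_isGorensteinProjective (toGamma h n).asEquivalence

end Equivalence

theorem projective_biproduct {C : Type v} [Category.{w} C] [HasZeroMorphisms C] {J : Type*}
    {F : J → C} [HasBiproduct F] (hF : ∀ j, Projective (F j)) : Projective (⨁ F) where
  factors f e _ := ⟨biproduct.desc fun j => Projective.factorThru (biproduct.ι F j ≫ f) e,
    biproduct.hom_ext' _ _ fun j => by simp⟩

/-! ### Component functors and factorizations free or cofree on one component. -/

section Adjunctions

variable {A : Type u} [Ring A] {ω : A} {h : IsRegularNormal ω} {n : ℕ}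

theorem windHom_surjective (h : IsRegularNormal ω) (i j : Fin n) :
    Function.Surjective (windHom h i j) := by
  unfold windHom
  split_ifs
  · exact Function.surjective_id
  · exact h.sigma.surjective

variable [NeZero n]

namespace ModFact

theorem hom_eq_of_lin_eq {X Y : ModFact h n} {i : Fin n}
    (hY : ∀ j, Function.Bijective (Y.tr i j)) {f g : Y ⟶ X} (e : Hom.lin f i = Hom.lin g i) :
    f = g :=
  hom_ext_lin fun j y => by
    obtain ⟨z, rfl⟩ := (hY j).2 y
    rw [Hom.lin_tr, Hom.lin_tr, e]

/-- Such a `Y` is free on its `i`-th component: at position `j` the morphism must be `g` conjugated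
by the transition maps. Surjectivity of `windHom` allows scalars to be moved back through the
inverse of a semilinear transition map. -/
theorem exists_hom_of_lin {X Y : ModFact h n} {i : Fin n}
    (hY : ∀ j, Function.Bijective (Y.tr i j)) (g : Y.component i →ₗ[A] X.component i) :
    ∃ f : Y ⟶ X, Hom.lin f i = g := by
  let e : ∀ j, Y.component i ≃+ Y.component j := fun j => AddEquiv.ofBijective (Y.tr i j) (hY j)
  have he : ∀ j z, (e j).symm (Y.tr i j z) = z := fun j z => (e j).symm_apply_apply z
  refine ⟨homMk (fun j =>
    { toFun := fun y => X.tr i j (g ((e j).symm y))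
      map_add' := fun y y' => by simp only [map_add]
      map_smul' := fun a y => by
        obtain ⟨z, rfl⟩ := (hY j).2 y
        obtain ⟨b, rfl⟩ := windHom_surjective h i j a
        rw [← tr_smul, he, he, map_smul, tr_smul, RingHom.id_apply] }) fun j k y => ?_, ?_⟩
  · obtain ⟨z, rfl⟩ := (hY j).2 y
    change X.tr i k (g ((e k).symm (Y.tr j k (Y.tr i j z)))) =
      X.tr j k (X.tr i j (g ((e j).symm (Y.tr i j z))))
    obtain ⟨b, hb⟩ := windHom_surjective h i k (ω ^ (wind i j + wind j k - wind i k))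
    rw [he, tr_tr, tr_tr, ← hb, ← tr_smul, ← tr_smul, he, map_smul]
  · ext y
    rw [lin_homMk]
    change X.tr i i (g ((e i).symm y)) = g y
    conv_lhs => rw [← tr_self Y y]
    rw [he, tr_self]

theorem cohom_eq_of_lin_eq {X Y : ModFact h n} {p : Fin n}
    (hY : ∀ j, Function.Bijective (Y.tr j p)) {f g : X ⟶ Y} (e : Hom.lin f p = Hom.lin g p) :
    f = g :=
  hom_ext_lin fun j x => (hY j).1 (by rw [← Hom.lin_tr, ← Hom.lin_tr, e])

/-- Dually, `Y` is cofree on its `p`-th component. -/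
theorem exists_cohom_of_lin {X Y : ModFact h n} {p : Fin n}
    (hY : ∀ j, Function.Bijective (Y.tr j p)) (g : X.component p →ₗ[A] Y.component p) :
    ∃ f : X ⟶ Y, Hom.lin f p = g := by
  let e : ∀ j, Y.component j ≃+ Y.component p := fun j => AddEquiv.ofBijective (Y.tr j p) (hY j)
  have he : ∀ j z, Y.tr j p ((e j).symm z) = z := fun j z => (e j).apply_symm_apply z
  refine ⟨homMk (fun j =>
    { toFun := fun x => (e j).symm (g (X.tr j p x))
      map_add' := fun y y' => by simp only [map_add]
      map_smul' := fun a x => (hY j).1 (by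
        rw [he, tr_smul, tr_smul, RingHom.id_apply, he, map_smul]) }) fun j k x => (hY k).1 ?_, ?_⟩
  · change Y.tr k p ((e k).symm (g (X.tr k p (X.tr j k x)))) =
      Y.tr k p (Y.tr j k ((e j).symm (g (X.tr j p x))))
    rw [he, tr_tr, tr_tr, he, map_smul]
  · ext x
    rw [lin_homMk]
    apply (hY p).1
    change Y.tr p p ((e p).symm (g (X.tr p p x))) = _
    rw [he, tr_self, tr_self]

end ModFact

/-! ### Transition maps of trivial module factorizations -/

theorem theta_tr_of_le {i j k : Fin n} (hjk : j ≤ k) (M : ModuleCat.{u} A) (x : M) :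
    (theta h i M).tr j k x = (thetaScalar ω i j k • x : M) :=
  (theta h i M).tr_of_le hjk x

theorem theta_tr_of_not_le {i j k : Fin n} (hjk : ¬ j ≤ k) (M : ModuleCat.{u} A) (x : M) :
    (theta h i M).tr j k x = (thetaScalar ω i 0 k • thetaLastScalar ω i •
      thetaScalar ω i j (lastIdx n) • x : M) :=
  (theta h i M).tr_of_not_le hjk x

/-- The only `ω` in `θⁱ` sits on the arrow into position `i`, which the cyclic path from `i` to `j`
never traverses. -/
theorem theta_tr_left (i j : Fin n) (M : ModuleCat.{u} A) (x : M) :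
    (theta h i M).tr i j x = (x : M) := by
  by_cases hij : i ≤ j
  · refine (theta_tr_of_le hij M x).trans ?_
    simp [thetaScalar]
    rfl
  · refine (theta_tr_of_not_le hij M x).trans ?_
    have : i ≠ 0 := fun c => hij (c ▸ zero_le_idx j)
    simp [thetaScalar, thetaLastScalar, hij, this]
    rfl

/-- The cyclic successor. -/
def cycSucc (p : Fin n) : Fin n := if hp : p.1 + 1 < n then ⟨p.1 + 1, hp⟩ else 0

theorem cycSucc_surjective (i : Fin n) : ∃ p, cycSucc p = i := by
  by_cases hi : i = 0
  · refine ⟨lastIdx n, ?_⟩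
    subst hi
    rw [cycSucc, dif_neg]
    have := NeZero.pos n
    simp only [lastIdx]
    omega
  · have h0 : i.1 ≠ 0 := fun c => hi (Fin.ext c)
    have := i.2
    refine ⟨⟨i.1 - 1, by omega⟩, ?_⟩
    rw [cycSucc, dif_pos (by change i.1 - 1 + 1 < n; omega)]
    exact Fin.ext (by change i.1 - 1 + 1 = i.1; omega)

/-- In `θᵖ⁺¹` the only `ω` sits on the arrow leaving position `p`, which a cyclic path ending at `p`
never traverses. So trivial factorizations are cofree as well as free. -/
theorem theta_tr_right (p j : Fin n) (M : ModuleCat.{u} A) (x : M) :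
    (theta h (cycSucc p) M).tr j p x = (x : M) := by
  by_cases hp : p.1 + 1 < n
  · have hc : cycSucc p = ⟨p.1 + 1, hp⟩ := dif_pos hp
    rw [hc]
    have h1 : ¬ (⟨p.1 + 1, hp⟩ : Fin n) ≤ p := by rw [Fin.le_def]; simp
    by_cases hj : j ≤ p
    · refine (theta_tr_of_le hj M x).trans ?_
      simp [thetaScalar, h1]
      rfl
    · refine (theta_tr_of_not_le hj M x).trans ?_
      have h2 : (⟨p.1 + 1, hp⟩ : Fin n) ≠ 0 := fun c => by
        have := congrArg Fin.val c
        simp at this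
      have h3 : ¬ j < (⟨p.1 + 1, hp⟩ : Fin n) := by
        rw [Fin.le_def] at hj
        rw [Fin.lt_def]
        simp only
        omega
      simp [thetaScalar, thetaLastScalar, h1, h2, h3]
      rfl
  · have hc : cycSucc p = 0 := dif_neg hp
    rw [hc]
    have hj : j ≤ p := by
      rw [Fin.le_def]
      have := j.2
      omega
    refine (theta_tr_of_le hj M x).trans ?_
    simp [thetaScalar]
    rfl

theorem theta_tr_left_bijective (i j : Fin n) (M : ModuleCat.{u} A) :
    Function.Bijective ((theta h i M).tr i j) := by
  rw [show ⇑((theta h i M).tr i j) = fun x : M => x from funext (theta_tr_left i j M)]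
  exact Function.bijective_id

theorem theta_tr_right_bijective (p j : Fin n) (M : ModuleCat.{u} A) :
    Function.Bijective ((theta h (cycSucc p) M).tr j p) := by
  rw [show ⇑((theta h (cycSucc p) M).tr j p) = fun x : M => x from
    funext (theta_tr_right p j M)]
  exact Function.bijective_id

/-! ### The adjoints of the component functors -/

variable (h) in
/-- The functor sending a module factorization to its `i`-th component. -/
def ev (i : Fin n) : ModFact h n ⥤ ModuleCat.{u} A where
  obj X := X.component i
  map f := (ModFact.Hom.app f).app i

instance (i : Fin n) : (ev h i).Additive where
  map_add := rfl

theorem ev_bijective_of_left {X Y : ModFact h n} {i : Fin n}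
    (hY : ∀ j, Function.Bijective (Y.tr i j)) :
    Function.Bijective ((ev h i).map : (Y ⟶ X) → _) := by
  refine ⟨fun f g e => ModFact.hom_eq_of_lin_eq hY (congrArg (fun φ => φ.hom) e), fun g => ?_⟩
  obtain ⟨f, hf⟩ := ModFact.exists_hom_of_lin hY g.hom
  exact ⟨f, ModuleCat.hom_ext hf⟩

theorem ev_bijective_of_right {X Y : ModFact h n} {p : Fin n}
    (hY : ∀ j, Function.Bijective (Y.tr j p)) :
    Function.Bijective ((ev h p).map : (X ⟶ Y) → _) := by
  refine ⟨fun f g e => ModFact.cohom_eq_of_lin_eq hY (congrArg (fun φ => φ.hom) e), fun g => ?_⟩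
  obtain ⟨f, hf⟩ := ModFact.exists_cohom_of_lin hY g.hom
  exact ⟨f, ModuleCat.hom_ext hf⟩

variable (h) in
/-- The `i`-th component of `θⁱ(M)` is `M`. -/
noncomputable def thetaIso (i : Fin n) (M : ModuleCat.{u} A) : M ≅ (ev h i).obj (theta h i M) :=
  have key : ∀ a : A, thetaTwist h i i a = a := fun a => by
    rw [thetaTwist, if_neg (lt_irrefl i)]
    rfl
  { hom := ModuleCat.ofHom (Y := thetaObj h M i i)
      { toFun := fun x => (x : M)
        map_add' := fun _ _ => rfl
        map_smul' := fun a x => congrArg (· • (x : M)) (key a).symm }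
    inv := ModuleCat.ofHom (X := thetaObj h M i i)
      { toFun := fun x => (x : M)
        map_add' := fun _ _ => rfl
        map_smul' := fun a (x : M) => by
          change (thetaTwist h i i a • x : M) = a • x
          rw [key] } }

variable (h) in
/-- Morphisms from `θⁱ(M)` to `X` are morphisms from `M` to `Xⁱ`. -/
noncomputable def thetaHomEquiv (i : Fin n) (M : ModuleCat.{u} A) (X : ModFact h n) :
    (theta h i M ⟶ X) ≃ (M ⟶ (ev h i).obj X) :=
  (Equiv.ofBijective _ (ev_bijective_of_left fun j => theta_tr_left_bijective i j M)).trans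
    (thetaIso h i M).symm.homFromEquiv

theorem thetaHomEquiv_apply {i : Fin n} {M : ModuleCat.{u} A} {X : ModFact h n}
    (f : theta h i M ⟶ X) :
    thetaHomEquiv h i M X f = (thetaIso h i M).hom ≫ (ev h i).map f := rfl

variable (h) in
/-- The twist needed to obtain `M` as the `p`-th component of a trivial module factorization. -/
noncomputable def coTwist (p : Fin n) : A ≃+* A :=
  if p < cycSucc p then h.sigma else RingEquiv.refl A

variable (h) in
/-- The cofree module factorization on a module in position `p`. -/
noncomputable def coTheta (p : Fin n) (M : ModuleCat.{u} A) : ModFact h n :=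
  theta h (cycSucc p) ((ModuleCat.restrictScalars (coTwist h p : A →+* A)).obj M)

variable (h) in
/-- The `p`-th component of the cofree module factorization. -/
noncomputable def coThetaIso (p : Fin n) (M : ModuleCat.{u} A) :
    (ev h p).obj (coTheta h p M) ≅ M :=
  have key : ∀ a : A, coTwist h p (thetaTwist h (cycSucc p) p a) = a := fun a => by
    unfold coTwist thetaTwist
    split_ifs
    · exact h.sigma.apply_symm_apply a
    · rfl
  { hom := ModuleCat.ofHom (X := thetaObj h
        ((ModuleCat.restrictScalars (coTwist h p : A →+* A)).obj M) (cycSucc p) p)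
      { toFun := fun x => (x : M)
        map_add' := fun _ _ => rfl
        map_smul' := fun a (x : M) => by
          change (coTwist h p (thetaTwist h (cycSucc p) p a) • x : M) = a • x
          rw [key] }
    inv := ModuleCat.ofHom (Y := thetaObj h
        ((ModuleCat.restrictScalars (coTwist h p : A →+* A)).obj M) (cycSucc p) p)
      { toFun := fun x => (x : M)
        map_add' := fun _ _ => rfl
        map_smul' := fun a x => congrArg (· • (x : M)) (key a).symm } }

variable (h) in
/-- Morphisms from `X` to the cofree module factorization on `M` are morphisms from `Xᵖ` to
`M`. -/
noncomputable def coThetaHomEquiv (p : Fin n) (M : ModuleCat.{u} A) (X : ModFact h n) :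
    ((ev h p).obj X ⟶ M) ≃ (X ⟶ coTheta h p M) :=
  (coThetaIso h p M).symm.homToEquiv.trans
    (Equiv.ofBijective _ (ev_bijective_of_right (Y := coTheta h p M)
      fun j => theta_tr_right_bijective p j _)).symm

theorem coThetaHomEquiv_symm_apply {p : Fin n} {M : ModuleCat.{u} A} {X : ModFact h n}
    (f : X ⟶ coTheta h p M) :
    (coThetaHomEquiv h p M X).symm f = (ev h p).map f ≫ (coThetaIso h p M).hom := rfl

variable (h) in
/-- The left adjoint of the `i`-th component functor. -/
noncomputable def thetaAdjunction (i : Fin n) :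
    Adjunction.leftAdjointOfEquiv (G := ev h i) (thetaHomEquiv h i)
      (fun _ _ _ _ _ => by simp [thetaHomEquiv_apply]) ⊣ ev h i :=
  Adjunction.adjunctionOfEquivLeft _ _

theorem coThetaHomEquiv_naturality {p : Fin n} {X' X : ModFact h n} (M : ModuleCat.{u} A)
    (f : X' ⟶ X) (g : (ev h p).obj X ⟶ M) :
    coThetaHomEquiv h p M X' ((ev h p).map f ≫ g) = f ≫ coThetaHomEquiv h p M X g := by
  rw [← Equiv.eq_symm_apply, coThetaHomEquiv_symm_apply, Functor.map_comp, Category.assoc,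
    ← coThetaHomEquiv_symm_apply, Equiv.symm_apply_apply]

variable (h) in
/-- The right adjoint of the `p`-th component functor. -/
noncomputable def coThetaAdjunction (p : Fin n) :
    ev h p ⊣ Adjunction.rightAdjointOfEquiv (F := ev h p)
      (fun X M => coThetaHomEquiv h p M X)
      (fun _ _ M f g => coThetaHomEquiv_naturality M f g) :=
  Adjunction.adjunctionOfEquivRight _ _

/-- Having adjoints on both sides, the component functors are exact, so short exact sequences can be
evaluated componentwise. -/
instance (i : Fin n) : (ev h i).IsRightAdjoint := (thetaAdjunction h i).isRightAdjoint
instance (i : Fin n) : (ev h i).IsLeftAdjoint := (coThetaAdjunction h i).isLeftAdjoint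

theorem epi_of_forall_ev {X Y : ModFact h n} (f : X ⟶ Y) (hf : ∀ i, Epi ((ev h i).map f)) :
    Epi f where
  left_cancellation g g' e := ModFact.hom_ext (NatTrans.ext (funext fun i =>
    (cancel_epi ((ev h i).map f)).1 (by
      have := congrArg (ev h i).map e
      rwa [Functor.map_comp, Functor.map_comp] at this)))

theorem mono_of_forall_ev {X Y : ModFact h n} (f : X ⟶ Y) (hf : ∀ i, Mono ((ev h i).map f)) :
    Mono f where
  right_cancellation g g' e := ModFact.hom_ext (NatTrans.ext (funext fun i =>
    (cancel_mono ((ev h i).map f)).1 (by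
      have := congrArg (ev h i).map e
      rwa [Functor.map_comp, Functor.map_comp] at this)))

instance : HasFiniteBiproducts (ModFact h n) := HasFiniteBiproducts.of_hasFiniteProducts

/-! ### Projective module factorizations -/

theorem projective_restrictScalars (e : A ≃+* A) {P : ModuleCat.{u} A} (hP : Projective P) :
    Projective ((ModuleCat.restrictScalars (e : A →+* A)).obj P) :=
  ((ModuleCat.restrictScalarsEquivalenceOfRingEquiv e).map_projective_iff P).2 hP

theorem projective_theta (i : Fin n) {P : ModuleCat.{u} A} (hP : Projective P) :
    Projective (theta h i P) :=
  (thetaAdjunction h i).map_projective P hP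

/-- The cofree objects are again trivial factorizations. Thus the right adjoint of `ev` preserves
projectives, which is the source of the symmetry between syzygies and cosyzygies in `GF`. -/
theorem projective_coTheta (p : Fin n) {P : ModuleCat.{u} A} (hP : Projective P) :
    Projective (coTheta h p P) :=
  projective_theta _ (projective_restrictScalars _ hP)

theorem projective_ev_theta (i j : Fin n) {P : ModuleCat.{u} A} (hP : Projective P) :
    Projective ((ev h j).obj (theta h i P)) := by
  change Projective ((ModuleCat.restrictScalars (thetaTwist h i j)).obj P)
  unfold thetaTwist
  split_ifs
  · exact projective_restrictScalars h.sigma.symm hP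
  · exact projective_restrictScalars (RingEquiv.refl A) hP

/-- The morphism from a sum of trivial module factorizations defined by its components. -/
noncomputable def thetaDesc {P : Fin n → ModuleCat.{u} A} {X : ModFact h n}
    (p : ∀ i, P i ⟶ (ev h i).obj X) : (⨁ fun i => theta h i (P i)) ⟶ X :=
  biproduct.desc fun i => (thetaHomEquiv h i (P i) X).symm (p i)

theorem thetaIso_ι_thetaDesc {P : Fin n → ModuleCat.{u} A} {X : ModFact h n}
    (p : ∀ i, P i ⟶ (ev h i).obj X) (i : Fin n) :
    ((thetaIso h i (P i)).hom ≫ (ev h i).map (biproduct.ι (fun i => theta h i (P i)) i)) ≫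
      (ev h i).map (thetaDesc p) = p i := by
  rw [Category.assoc, ← Functor.map_comp, thetaDesc, biproduct.ι_desc, ← thetaHomEquiv_apply,
    Equiv.apply_symm_apply]

theorem epi_thetaDesc {P : Fin n → ModuleCat.{u} A} {X : ModFact h n}
    (p : ∀ i, P i ⟶ (ev h i).obj X) (hp : ∀ i, Epi (p i)) : Epi (thetaDesc p) :=
  epi_of_forall_ev _ fun i => by
    have := hp i
    rw [← thetaIso_ι_thetaDesc p i] at this
    exact @epi_of_epi _ _ _ _ _ _ _ this

/-- The morphism to a sum of cofree module factorizations defined by its components. -/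
noncomputable def coThetaLift {P : Fin n → ModuleCat.{u} A} {X : ModFact h n}
    (f : ∀ i, (ev h i).obj X ⟶ P i) : X ⟶ ⨁ fun i => coTheta h i (P i) :=
  biproduct.lift fun i => coThetaHomEquiv h i (P i) X (f i)

theorem coThetaLift_π_coThetaIso {P : Fin n → ModuleCat.{u} A} {X : ModFact h n}
    (f : ∀ i, (ev h i).obj X ⟶ P i) (i : Fin n) :
    (ev h i).map (coThetaLift f) ≫ (ev h i).map (biproduct.π (fun i => coTheta h i (P i)) i) ≫
      (coThetaIso h i (P i)).hom = f i := by
  rw [← Category.assoc, ← Functor.map_comp, coThetaLift, biproduct.lift_π,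
    ← coThetaHomEquiv_symm_apply, Equiv.symm_apply_apply]

theorem mono_coThetaLift {P : Fin n → ModuleCat.{u} A} {X : ModFact h n}
    (f : ∀ i, (ev h i).obj X ⟶ P i) (hf : ∀ i, Mono (f i)) : Mono (coThetaLift f) :=
  mono_of_forall_ev _ fun i => by
    have := hf i
    rw [← coThetaLift_π_coThetaIso f i] at this
    exact @mono_of_mono _ _ _ _ _ _ _ this

theorem exists_retract_theta {X : ModFact h n} (hX : Projective X) :
    ∃ P : Fin n → ModuleCat.{u} A, (∀ i, Projective (P i)) ∧
      ∃ φ : (⨁ fun i => theta h i (P i)) ⟶ X, Epi φ ∧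
        Nonempty (Retract X (⨁ fun i => theta h i (P i))) := by
  let p : ∀ i, Projective.over ((ev h i).obj X) ⟶ (ev h i).obj X := fun i => Projective.π _
  have := epi_thetaDesc p inferInstance
  exact ⟨fun i => Projective.over ((ev h i).obj X), fun i => inferInstance, thetaDesc p, this,
    ⟨⟨Projective.factorThru (𝟙 X) (thetaDesc p), thetaDesc p, Projective.factorThru_comp _ _⟩⟩⟩

theorem projective_ev {X : ModFact h n} (hX : Projective X) (j : Fin n) :
    Projective ((ev h j).obj X) := by
  obtain ⟨P, hP, φ, -, ⟨r⟩⟩ := exists_retract_theta hX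
  have : Projective ((ev h j).obj (⨁ fun i => theta h i (P i))) :=
    Projective.of_iso ((ev h j).mapBiproduct fun i => theta h i (P i)).symm
      (projective_biproduct fun i => projective_ev_theta i j (hP i))
  exact (r.map (ev h j)).projective

theorem isSummandOfTrivial_iff {X : ModFact h n} : IsSummandOfTrivial X ↔ Projective X := by
  constructor
  · rintro ⟨P, hP, b, ⟨hb⟩, Z, c, ⟨hc⟩, ⟨e⟩⟩
    have : Projective b.pt := Projective.of_iso (biproduct.uniqueUpToIso _ hb).symm
      (projective_biproduct fun i => projective_theta i (hP i))
    exact Retract.projective (Y := b.pt) ⟨c.inl ≫ e.hom, e.inv ≫ c.fst, by simp⟩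
  · intro hX
    obtain ⟨P, hP, φ, hφ, -⟩ := exists_retract_theta hX
    obtain ⟨e⟩ := nonempty_iso_biprod (shortExact_kernel φ) (extVanishes_of_projective hX _)
    exact ⟨P, hP, biproduct.bicone _, ⟨biproduct.isBilimit _⟩, kernel φ,
      BinaryBiproduct.bicone _ _, ⟨BinaryBiproduct.isBilimit _ _⟩, ⟨biprod.braiding _ _ ≪≫ e⟩⟩

/-! ### Gorenstein projective module factorizations -/

/-- It suffices to treat `Q = θⁱ(P)`. Writing `i` as the cyclic successor of `p`, maps into `Q` are
maps of `p`-th components, so the extension problem is solved over `A`, where `Xᵖ` is Gorenstein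
projective and the `p`-th component of `Q` is projective. -/
theorem extProjVanishes_of_GF {X : ModFact h n} (hX : GF h n X) : ExtProjVanishes X := by
  intro Q hQ
  obtain ⟨P, hP, φ, -, ⟨r⟩⟩ := exists_retract_theta hQ
  refine ExtVanishes.of_retract (ExtVanishes.biproduct fun i => ?_) r
  obtain ⟨p, rfl⟩ := cycSucc_surjective i
  intro K E a b z hS f
  obtain ⟨g, hg⟩ := (hX p).extProjVanishes _ (projective_ev_theta (cycSucc p) p (hP (cycSucc p)))
    ((ev h p).map a) ((ev h p).map b) (congrArg (ev h p).map z)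
    (hS.map_of_exact (ev h p)) ((ev h p).map f)
  obtain ⟨g', rfl⟩ := (ev_bijective_of_right fun j => theta_tr_right_bijective p j _).2 g
  exact ⟨g', (ev_bijective_of_right fun j => theta_tr_right_bijective p j _).1
    (by rw [Functor.map_comp, hg])⟩

/-- Embeddings `Xʲ ⟶ Pʲ` with Gorenstein projective cokernels assemble, by adjunction, to an
embedding of `X` in a sum of cofree objects. Its `j`-th component followed by a split epimorphism
onto `Pʲ` is the original embedding, so `isGorensteinProjective_cokernel` applies. -/
theorem exists_cosyzygy_of_GF {X : ModFact h n} (hX : GF h n X) :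
    ∃ Y, GF h n Y ∧ IsSyzygy X Y := by
  choose Y hY P i p z hP hS using fun j => (hX j).exists_cosyzygy
  have hm := mono_coThetaLift (X := X) i fun j => (hS j).mono_f
  have hE : Projective (⨁ fun j => coTheta h j (P j)) :=
    projective_biproduct fun j => projective_coTheta j (hP j)
  refine ⟨cokernel (coThetaLift (X := X) i), fun j => ?_, _, _, _, _, hE, shortExact_cokernel _⟩
  have e := coThetaLift_π_coThetaIso (X := X) i j
  refine isGorensteinProjective_cokernel
    ((shortExact_cokernel (coThetaLift (X := X) i)).map_of_exact (ev h j)) (projective_ev hE j)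
    ((ev h j).map (biproduct.π (fun j => coTheta h j (P j)) j) ≫ (coThetaIso h j (P j)).hom)
    ((coThetaIso h j (P j)).inv ≫ (ev h j).map (biproduct.ι (fun j => coTheta h j (P j)) j))
    ?_ (ρ := p j) (z' := (congrArg (· ≫ p j) e).trans (z j)) ?_ (hY j)
  · rw [Category.assoc, ← Functor.map_comp_assoc, biproduct.ι_π_self]
    simp
  · exact ShortComplex.shortExact_of_iso (S₁ := ShortComplex.mk (i j) (p j) (z j))
      (ShortComplex.isoMk (Iso.refl _) (Iso.refl _) (Iso.refl _)
        ((Category.id_comp _).trans (e.trans (Category.comp_id _).symm))) (hS j)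

/-- The dual construction, with free objects covering `X` and `isGorensteinProjective_kernel` in
each component. -/
theorem exists_syzygy_of_GF {X : ModFact h n} (hX : GF h n X) :
    ∃ Y, GF h n Y ∧ IsSyzygy Y X := by
  choose Y hY P i p z hP hS using fun j => (hX j).exists_syzygy
  have hm := epi_thetaDesc (X := X) p fun j => (hS j).epi_g
  have hE : Projective (⨁ fun j => theta h j (P j)) :=
    projective_biproduct fun j => projective_theta j (hP j)
  refine ⟨kernel (thetaDesc (X := X) p), fun j => ?_, _, _, _, _, hE, shortExact_kernel _⟩
  have e := thetaIso_ι_thetaDesc (X := X) p j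
  refine isGorensteinProjective_kernel
    ((shortExact_kernel (thetaDesc (X := X) p)).map_of_exact (ev h j)) (projective_ev hE j)
    ((thetaIso h j (P j)).hom ≫ (ev h j).map (biproduct.ι (fun j => theta h j (P j)) j))
    ((ev h j).map (biproduct.π (fun j => theta h j (P j)) j) ≫ (thetaIso h j (P j)).inv)
    ?_ (ρ := i j) (z' := (congrArg (i j ≫ ·) e).trans (z j)) ?_ (hY j)
  · rw [Category.assoc, ← Functor.map_comp_assoc, biproduct.ι_π_self]
    simp
  · exact ShortComplex.shortExact_of_iso (S₁ := ShortComplex.mk (i j) (p j) (z j))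
      (ShortComplex.isoMk (Iso.refl _) (Iso.refl _) (Iso.refl _) (by simp)
        ((Category.id_comp _).trans (e.trans (Category.comp_id _).symm))) (hS j)

theorem GF_eq_isGorensteinProjective :
    GF h n = IsGorensteinProjective (C := ModFact h n) := by
  ext X
  refine ⟨fun hX => isGorensteinProjective_of_class (fun _ => exists_cosyzygy_of_GF)
    (fun _ => exists_syzygy_of_GF) (fun _ => extProjVanishes_of_GF) X hX, fun hX j => ?_⟩
  exact hX.map_of_adjunction (ev h j) _ (coThetaAdjunction h j)
    (fun _ hP => projective_ev hP j) (fun _ hQ => projective_coTheta j hQ)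

end Adjunctions

end NFold

theorem proposition3 {A : Type u} [Ring A] [IsNoetherianRing A] {ω : A}
    (h : NFold.IsRegularNormal ω) (n : ℕ) [NeZero n] :
    NFold.GF h n = NFold.IsGorensteinProjective (C := NFold.ModFact h n) ∧
    NFold.ExactEquivalent
      (NFold.conflations (NFold.GF h n))
      (NFold.conflations
        (NFold.IsGorensteinProjective (C := ModuleCat.{u} (NFold.Gamma h n)))) ∧
    NFold.IsFrobenius (NFold.conflations (NFold.GF h n)) ∧
    ∀ X : NFold.ModFact h n,
      (∃ hX : NFold.GF h n X,
        NFold.IsExactProjective (NFold.conflations (NFold.GF h n)) ⟨X, hX⟩ ∧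
        NFold.IsExactInjective (NFold.conflations (NFold.GF h n)) ⟨X, hX⟩) ↔
      NFold.IsSummandOfTrivial X := by
  refine ⟨NFold.GF_eq_isGorensteinProjective, ?_⟩
  rw [NFold.GF_eq_isGorensteinProjective]
  refine ⟨NFold.exactEquivalent_gamma, NFold.isFrobenius_isGorensteinProjective, fun X => ?_⟩
  rw [NFold.isSummandOfTrivial_iff]
  constructor
  · rintro ⟨hX, hp, -⟩
    exact NFold.isExactProjective_iff.1 hp
  · exact fun hX => ⟨hX.isGorensteinProjective, NFold.isExactProjective_iff.2 hX,
      NFold.isExactInjective_iff.2 hX⟩
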